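/- Let $\sigma(z)=\max\{0,z\}$ act entrywise, with derivative $\sigma'(z)=\mathbf 1\{z>0\}$. For a real matrix $M$, $\lambda_i(M)$ is its $i$-th largest singular value. Let $W^\natural\in\mathbb R^{d\times k}$ and $\Delta\in\mathbb R^{d\times k}$ with $1\le r^*:=\operatorname{rank}\Delta<\min\{d,k\}$. Put $\lambda^*_i=\lambda_i(\Delta)$, $\kappa=\lambda^*_1/\lambda^*_{r^*}$, $\widetilde W=W^\natural+\Delta$, with columns $\widetilde w_1,\dots,\widetilde w_k$, and let $\Delta_1,\dots,\Delta_k$ be the columns of $\Delta$. Let $d<N$, let $\widetilde X\in\mathbb R^{N\times d}$ have i.i.d. rows $\widetilde x_i\sim\mathcal N(0,I_d)$, and let $$G^\natural=-\nabla L(W^\natural)=\tfrac1N\widetilde X^\top\big([\sigma(\widetilde X\widetilde W)-\sigma(\widetilde XW^\natural)]\odot\sigma'(\widetilde XW^\natural)\big),\qquad L(W)=\tfrac1{2N}\|\sigma(\widetilde XW)-\sigma(\widetilde X\widetilde W)\|_F^2 .$$ For a complete singular value decomposition $G^\natural=USV^\top$ (singular values in nonincreasing order), the spectral initialization with $\gamma=2$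 and rank $r=r^*$ is $$A_0=\sqrt\gamma\,U_{[:,1:r]}\,(S^{1/2})_{[1:r]},\qquad B_0=\sqrt\gamma\,(S^{1/2})_{[1:r]}\,(V_{[:,1:r]})^\top .$$ There are universal constants $C>0$ and $C^*>0$, and for every $c_1>0$ there is $c_0=c_0(c_1)>0$, such that the following holds for all $\rho>0$, all $0<c_2\le c_0\rho$ and all $d,k,N,r^*,W^\natural,\Delta$ as above. Suppose that for every $m\in\{1,\dots,k\}$ we have $\widetilde w_m\ne0$, $$\frac{\|\widetilde W\|_{op}}{\|\widetilde w_m\|_2}\le c_1,\qquad \frac{\max\{\lambda^*_{r^*},\|\Delta_m\|_2\}}{\|\widetilde w_m\|_2}\le\frac{c_2}{\kappa r^*},$$ and let $0<\epsilon<1$ satisfy $$\epsilon\le\frac{\rho}{3C^*K^2\gamma\sqrt{2d}\,r^*\kappa},\qquad K=\sqrt{8/3},\quad\gamma=2 .$$ Then with probability at least $1-2Cdk\exp(-N\epsilon^2)$, for every choice of the singular value decomposition, $$\|A_0B_0-\Delta\|_F\le\rho\,\lambda^*_{r^*}.$$ -/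

import Mathlib

open MeasureTheory ProbabilityTheory

noncomputable section

namespace LoRA

/-! ### Matrix notions -/

/-- The Frobenius norm. -/
def frobNorm {d k : ℕ} (M : Matrix (Fin d) (Fin k) ℝ) : ℝ :=
  Real.sqrt (∑ i, ∑ j, M i j ^ 2)

theorem frobNorm_sq {d k : ℕ} (M : Matrix (Fin d) (Fin k) ℝ) :
    frobNorm M ^ 2 = ∑ i, ∑ j, M i j ^ 2 :=
  Real.sq_sqrt (Finset.sum_nonneg fun _ _ => Finset.sum_nonneg fun _ _ => sq_nonneg _)

/-- The operator norm with respect to the Euclidean norms. -/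
def opNorm {d k : ℕ} (M : Matrix (Fin d) (Fin k) ℝ) : ℝ :=
  ‖(Matrix.toEuclideanLin M).toContinuousLinearMap‖

/-- The Euclidean norm of the `m`-th column. -/
def colNorm {d k : ℕ} (M : Matrix (Fin d) (Fin k) ℝ) (m : Fin k) : ℝ :=
  Real.sqrt (∑ i, M i m ^ 2)

/-- The `i`-th largest singular value, counted from `i = 1`. -/
def singularValue {d k : ℕ} (M : Matrix (Fin d) (Fin k) ℝ) (i : ℕ) : ℝ :=
  (Matrix.toEuclideanLin M).singularValues (i - 1)

/-- The condition number: largest singular value over smallest nonzero singular value. -/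
def condNumber {d k : ℕ} (M : Matrix (Fin d) (Fin k) ℝ) : ℝ :=
  singularValue M 1 / singularValue M M.rank

/-- The rectangular diagonal matrix with diagonal `s`. -/
def rectDiagonal {d k : ℕ} (s : Fin (min d k) → ℝ) : Matrix (Fin d) (Fin k) ℝ :=
  Matrix.of fun i j =>
    if h : (i : ℕ) = (j : ℕ) then s ⟨i, lt_min i.isLt (h ▸ j.isLt)⟩ else 0

/-- `M = U S Vᵀ` is a complete singular value decomposition, with the singular values `s` on the
diagonal of `S` in nonincreasing order. -/
structure IsSVD {d k : ℕ} (M : Matrix (Fin d) (Fin k) ℝ) (U : Matrix (Fin d) (Fin d) ℝ)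
    (s : Fin (min d k) → ℝ) (V : Matrix (Fin k) (Fin k) ℝ) : Prop where
  left_orthogonal : U ∈ Matrix.orthogonalGroup (Fin d) ℝ
  right_orthogonal : V ∈ Matrix.orthogonalGroup (Fin k) ℝ
  nonneg : ∀ i, 0 ≤ s i
  antitone : Antitone s
  eq_mul : M = U * rectDiagonal s * V.transpose

/-- Every real matrix has a complete singular value decomposition. -/
theorem exists_isSVD {d k : ℕ} (M : Matrix (Fin d) (Fin k) ℝ) :
    ∃ U s V, IsSVD M U s V := by
  classical
  set T := Matrix.toEuclideanLin M with hT
  have hk : Module.finrank ℝ (EuclideanSpace ℝ (Fin k)) = k := by simp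
  have hd : Module.finrank ℝ (EuclideanSpace ℝ (Fin d)) = d := by simp
  set v := T.isSymmetric_adjoint_comp_self.eigenvectorBasis hk with hv
  set σ : ℕ → ℝ := fun i => T.singularValues i with hσ
  have hσ0 : ∀ i, 0 ≤ σ i := T.singularValues_nonneg
  have hin : ∀ i j : Fin k, inner ℝ (T (v i)) (T (v j)) = if i = j then σ i ^ 2 else 0 := by
    intro i j
    rw [← LinearMap.adjoint_inner_left]
    have h := T.isSymmetric_adjoint_comp_self.apply_eigenvectorBasis hk i
    rw [← hv, LinearMap.comp_apply] at h
    rw [h, inner_smul_left, orthonormal_iff_ite.1 v.orthonormal i j,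
      ← T.sq_singularValues_fin hk i]
    split_ifs <;> simp [hσ]
  have hbig : ∀ i, d ≤ i → σ i = 0 := by
    intro i hi
    by_contra hne
    have hmem : i ∈ T.singularValues.support := Finsupp.mem_support_iff.2 hne
    rw [T.support_singularValues] at hmem
    have h1 := LinearMap.finrank_range_le T
    have h2 := Submodule.finrank_le (LinearMap.range T)
    simp only [Finset.mem_range] at hmem
    omega
  -- left singular vectors, where defined
  let w : Fin d → EuclideanSpace ℝ (Fin d) := fun i =>
    if h : (i : ℕ) < k then (σ i)⁻¹ • T (v ⟨i, h⟩) else 0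
  let S : Set (Fin d) := {i | (i : ℕ) < k ∧ σ i ≠ 0}
  have hw : Orthonormal ℝ (S.domRestrict w) := by
    rw [orthonormal_iff_ite]
    rintro ⟨i, hi, hi0⟩ ⟨j, hj, hj0⟩
    change inner ℝ (w i) (w j) = _
    have hwi : w i = (σ i)⁻¹ • T (v ⟨i, hi⟩) := dif_pos hi
    have hwj : w j = (σ j)⁻¹ • T (v ⟨j, hj⟩) := dif_pos hj
    rw [hwi, hwj, inner_smul_left, inner_smul_right, hin]
    by_cases hij : i = j
    · subst hij
      simp only [if_true, conj_trivial]
      field_simp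
    · have hij' : (i : ℕ) ≠ j := fun h => hij (Fin.ext h)
      simp [hij, hij']
  obtain ⟨u, hu⟩ := hw.exists_orthonormalBasis_extension_of_card_eq (by simp)
  have hTv : ∀ (j : Fin k), T (v j) =
      if h : (j : ℕ) < d then σ j • u ⟨j, h⟩ else 0 := by
    intro j
    by_cases h0 : σ j = 0
    · have : T (v j) = 0 := by
        have := hin j j
        rw [if_pos rfl, h0] at this
        exact inner_self_eq_zero.1 (this.trans (by simp))
      rw [this]
      split_ifs <;> simp [h0]
    · have hjd : (j : ℕ) < d := by
        by_contra hge
        exact h0 (hbig _ (not_lt.1 hge))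
      rw [dif_pos hjd, hu ⟨j, hjd⟩ ⟨j.isLt, h0⟩]
      simp [w, smul_smul, h0]
  let U : Matrix (Fin d) (Fin d) ℝ := Matrix.of fun i j => u j i
  let V : Matrix (Fin k) (Fin k) ℝ := Matrix.of fun i j => v j i
  have hU : U.transpose * U = 1 := by
    ext i j
    have := orthonormal_iff_ite.1 u.orthonormal i j
    simp only [PiLp.inner_apply, RCLike.inner_apply, conj_trivial] at this
    simp only [Matrix.mul_apply, Matrix.transpose_apply, U, Matrix.of_apply, Matrix.one_apply,
      ← this]
    exact Finset.sum_congr rfl fun _ _ => mul_comm _ _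
  have hV : V.transpose * V = 1 := by
    ext i j
    have := orthonormal_iff_ite.1 v.orthonormal i j
    simp only [PiLp.inner_apply, RCLike.inner_apply, conj_trivial] at this
    simp only [Matrix.mul_apply, Matrix.transpose_apply, V, Matrix.of_apply, Matrix.one_apply,
      ← this]
    exact Finset.sum_congr rfl fun _ _ => mul_comm _ _
  have hV' : V * V.transpose = 1 := mul_eq_one_comm.1 hV
  refine ⟨U, fun i => σ i, V, (Matrix.mem_orthogonalGroup_iff' _ _).2 hU,
    (Matrix.mem_orthogonalGroup_iff' _ _).2 hV, fun i => hσ0 _,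
    fun i j hij => T.singularValues_antitone hij, ?_⟩
  have key : M * V = U * rectDiagonal fun i : Fin (min d k) => σ i := by
    ext i j
    have h1 : (M * V) i j = T (v j) i := by
      simp [hT, Matrix.mul_apply, V, Matrix.toLpLin_apply, Matrix.mulVec, dotProduct]
    rw [h1, hTv, Matrix.mul_apply]
    by_cases h : (j : ℕ) < d
    · rw [dif_pos h, Finset.sum_eq_single ⟨j, h⟩]
      · simp [rectDiagonal, U, mul_comm]
      · intro b _ hb
        have : (b : ℕ) ≠ j := fun hbj => hb (Fin.ext hbj)
        simp [rectDiagonal, this]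
      · simp
    · rw [dif_neg h, Finset.sum_eq_zero]
      · simp
      · intro b _
        have : (b : ℕ) ≠ j := fun hbj => h (hbj ▸ b.isLt)
        simp [rectDiagonal, this]
  rw [← key, Matrix.mul_assoc, hV', Matrix.mul_one]

/-! ### The ReLU model and its one-step gradient -/

/-- The ReLU activation. -/
def relu (z : ℝ) : ℝ := max 0 z

/-- The derivative of the ReLU activation (with the usual convention `0` at the kink). -/
def reluDeriv (z : ℝ) : ℝ := if 0 < z then 1 else 0

/-- The empirical squared loss of full fine-tuning, with data matrix `X` and with the labels
`σ(X Wt)` generated by the downstream matrix `Wt`. -/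
def loss {N d k : ℕ} (X : Matrix (Fin N) (Fin d) ℝ) (Wt W : Matrix (Fin d) (Fin k) ℝ) : ℝ :=
  1 / (2 * (N : ℝ)) * frobNorm ((X * W).map relu - (X * Wt).map relu) ^ 2

/-- The negative gradient of the empirical loss at `W`:
`(1/N) Xᵀ ([σ(X Wt) - σ(X W)] ⊙ σ'(X W))`. -/
def negGrad {N d k : ℕ} (X : Matrix (Fin N) (Fin d) ℝ) (Wt W : Matrix (Fin d) (Fin k) ℝ) :
    Matrix (Fin d) (Fin k) ℝ :=
  (1 / (N : ℝ)) • (X.transpose *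
    Matrix.hadamard ((X * Wt).map relu - (X * W).map relu) ((X * W).map reluDeriv))

/-- Away from the kinks, `negGrad` is the negative gradient of the loss: it represents all
directional derivatives with respect to the Frobenius inner product. -/
theorem hasDerivAt_loss {N d k : ℕ} (X : Matrix (Fin N) (Fin d) ℝ)
    (Wt W H : Matrix (Fin d) (Fin k) ℝ) (h : ∀ i m, (X * W) i m ≠ 0) :
    HasDerivAt (fun t : ℝ => loss X Wt (W + t • H)) (-∑ j, ∑ m, negGrad X Wt W j m * H j m) 0 := by
  have hrelu : ∀ z : ℝ, z ≠ 0 → HasDerivAt relu (reluDeriv z) z := by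
    intro z hz
    rcases lt_or_gt_of_ne hz with hz | hz
    · have : relu =ᶠ[nhds z] fun _ => 0 := by
        filter_upwards [gt_mem_nhds hz] with y hy
        exact max_eq_left hy.le
      rw [reluDeriv, if_neg hz.not_gt]
      exact (hasDerivAt_const z (0 : ℝ)).congr_of_eventuallyEq this
    · have : relu =ᶠ[nhds z] fun y => y := by
        filter_upwards [lt_mem_nhds hz] with y hy
        exact max_eq_right hy.le
      rw [reluDeriv, if_pos hz]
      exact (hasDerivAt_id z).congr_of_eventuallyEq this
  have hloss : ∀ t : ℝ, loss X Wt (W + t • H) = 1 / (2 * (N : ℝ)) *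
      ∑ i, ∑ m, (relu ((X * W) i m + t * (X * H) i m) - relu ((X * Wt) i m)) ^ 2 := by
    intro t
    rw [loss, frobNorm_sq]
    simp [Matrix.mul_add, Matrix.add_apply]
  simp_rw [hloss]
  have hterm : ∀ i m, HasDerivAt
      (fun t : ℝ => (relu ((X * W) i m + t * (X * H) i m) - relu ((X * Wt) i m)) ^ 2)
      (2 * ((relu ((X * W) i m) - relu ((X * Wt) i m)) *
        (reluDeriv ((X * W) i m) * (X * H) i m))) 0 := by
    intro i m
    have h1 : HasDerivAt (fun t : ℝ => (X * W) i m + t * (X * H) i m) ((X * H) i m) 0 := by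
      simpa using ((hasDerivAt_id (0 : ℝ)).mul_const ((X * H) i m)).const_add ((X * W) i m)
    have h2 : HasDerivAt relu (reluDeriv ((X * W) i m)) ((X * W) i m + 0 * (X * H) i m) := by
      simpa using hrelu _ (h i m)
    have h3 := ((h2.comp (0 : ℝ) h1).sub_const (relu ((X * Wt) i m))).pow 2
    refine h3.congr_deriv ?_
    simp
    ring
  refine ((HasDerivAt.fun_sum fun i _ => HasDerivAt.fun_sum fun m _ => hterm i m).const_mul
    (1 / (2 * (N : ℝ)))).congr_deriv ?_
  have hR : ∑ j, ∑ m, negGrad X Wt W j m * H j m = 1 / (N : ℝ) * ∑ i, ∑ m,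
      (relu ((X * Wt) i m) - relu ((X * W) i m)) * reluDeriv ((X * W) i m) * (X * H) i m := by
    have hJ : ∀ j m, negGrad X Wt W j m = 1 / (N : ℝ) * ∑ i, X i j *
        ((relu ((X * Wt) i m) - relu ((X * W) i m)) * reluDeriv ((X * W) i m)) := by
      intro j m
      rw [negGrad, Matrix.smul_apply, Matrix.mul_apply]
      rfl
    have hH : ∀ i m, (X * H) i m = ∑ j, X i j * H j m := fun i m => Matrix.mul_apply
    simp only [hJ, hH, Finset.mul_sum, Finset.sum_mul]
    calc _ = ∑ m, ∑ j, ∑ i, 1 / (N : ℝ) * (X i j *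
          ((relu ((X * Wt) i m) - relu ((X * W) i m)) * reluDeriv ((X * W) i m))) * H j m :=
          Finset.sum_comm
      _ = ∑ m, ∑ i, ∑ j, 1 / (N : ℝ) * (X i j *
          ((relu ((X * Wt) i m) - relu ((X * W) i m)) * reluDeriv ((X * W) i m))) * H j m :=
          Finset.sum_congr rfl fun _ _ => Finset.sum_comm
      _ = ∑ i, ∑ m, ∑ j, 1 / (N : ℝ) * (X i j *
          ((relu ((X * Wt) i m) - relu ((X * W) i m)) * reluDeriv ((X * W) i m))) * H j m :=
          Finset.sum_comm
      _ = _ := Finset.sum_congr rfl fun i _ => Finset.sum_congr rfl fun m _ =>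
          Finset.sum_congr rfl fun j _ => by ring
  rw [hR]
  simp only [Finset.mul_sum, ← Finset.sum_neg_distrib]
  refine Finset.sum_congr rfl fun i _ => Finset.sum_congr rfl fun m _ => ?_
  have : (1 / (2 * (N : ℝ))) = 1 / (N : ℝ) / 2 := by rw [div_div, mul_comm]
  rw [this]
  ring

/-! ### Spectral initialization -/

/-- `(A, B)` is a rank-`r` spectral initialization with parameter `γ` from the matrix `G`: for some
complete singular value decomposition `G = U S Vᵀ`,
`A = √γ U[:,1:r] (S^{1/2})[1:r]` and `B = √γ (S^{1/2})[1:r] (V[:,1:r])ᵀ`. -/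
def IsSpectralInit {d k r : ℕ} (γ : ℝ) (hr : r ≤ min d k) (G : Matrix (Fin d) (Fin k) ℝ)
    (A : Matrix (Fin d) (Fin r) ℝ) (B : Matrix (Fin r) (Fin k) ℝ) : Prop :=
  ∃ U s V, IsSVD G U s V ∧
    (A = Real.sqrt γ • (U.submatrix id (Fin.castLE (hr.trans (min_le_left d k))) *
      Matrix.diagonal fun l => Real.sqrt (s (Fin.castLE hr l)))) ∧
    (B = Real.sqrt γ • ((Matrix.diagonal fun l => Real.sqrt (s (Fin.castLE hr l))) *
      (V.submatrix id (Fin.castLE (hr.trans (min_le_right d k)))).transpose))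

/-! ### Assumptions -/

/-- Balance of the downstream neurons and smallness of the feature shift `Δ` (of rank `rs`) relative
to the downstream matrix `Wt`, with the implied constants `c₁` and `c₂`:
`‖Wt‖_op / ‖wt_m‖ ≤ c₁` and `max {λ_rs(Δ), ‖Δ_m‖} / ‖wt_m‖ ≤ c₂ / (κ rs)` for every column `m`. -/
structure ShiftAssumption {d k : ℕ} (c₁ c₂ : ℝ) (rs : ℕ) (Wt Δ : Matrix (Fin d) (Fin k) ℝ) :
    Prop where
  col_pos : ∀ m, 0 < colNorm Wt m
  balance : ∀ m, opNorm Wt / colNorm Wt m ≤ c₁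
  shift : ∀ m, max (singularValue Δ rs) (colNorm Δ m) / colNorm Wt m ≤
    c₂ / (condNumber Δ * (rs : ℝ))

/-- `x 0, …, x (N-1)` are i.i.d. standard Gaussian vectors in `ℝ^d`. -/
structure IsGaussianSample {Ω : Type*} [MeasurableSpace Ω] (μ : Measure Ω) {N d : ℕ}
    (x : Fin N → Ω → EuclideanSpace ℝ (Fin d)) : Prop where
  law : ∀ i, HasLaw (x i) (stdGaussian (EuclideanSpace ℝ (Fin d))) μ
  indep : iIndepFun x μ

/-- The data matrix whose rows are the sample points. -/
def dataMatrix {Ω : Type*} {N d : ℕ} (x : Fin N → Ω → EuclideanSpace ℝ (Fin d)) (ω : Ω) :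
    Matrix (Fin N) (Fin d) ℝ :=
  Matrix.of fun i j => x i ω j

end LoRA

end

open MeasureTheory ProbabilityTheory

noncomputable section

namespace LoRA

/-! ### The Frobenius norm -/

/-! The point is that `negGrad` at the pretrained weights is close to `Δ / 2`. For `a ≠ 0`, the
reflection `x ↦ -x` swaps the half-spaces `⟪a, x⟫ > 0` and `⟪a, x⟫ < 0`, so `E[x ⟪b, x⟫ 1{⟪a, x⟫ >
0}] = b / 2`. A true gradient column replaces `⟪b, x⟫ 1{⟪a, x⟫ > 0}` by `gatedShift a b x`. The two
differ only where adding `b` flips the sign of an active neuron, and there `|⟪a + b, x⟫| ≤ |⟪b,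
x⟫|`. This slab has Gaussian probability of order `‖b‖ / ‖a + b‖` and the integrand carries a
further factor `‖b‖`, so the bias is second order: `102 ‖Δ_m‖² / ‖w̃_m‖` in column `m`
(`integral_abs_inner_mul_ite_le`, `colNorm_meanGrad_sub_le`).

Each gradient entry is an average of i.i.d. variables dominated by a product of two Gaussians. A
Bernstein bound and a union over the `d k` entries keep column `m` within `48 ε √d ‖Δ_m‖` of its
mean (`exists_measurableSet_abs_negGrad_sub_le`).

Both errors are relative to `‖Δ_m‖`, so they sum to a multiple of `‖Δ‖_F ≤ √r κ λ_r`. Finally `A₀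
B₀` is twice the rank-`r` truncation of the gradient, and Eckart–Young gives `‖A₀ B₀ - Δ‖_F ≤ 4 ‖G -
Δ / 2‖_F` (`IsSpectralInit.frobNorm_mul_sub_le`). -/

theorem frobNorm_nonneg {d k : ℕ} (M : Matrix (Fin d) (Fin k) ℝ) : 0 ≤ frobNorm M :=
  Real.sqrt_nonneg _

attribute [local instance] Matrix.frobeniusNormedAddCommGroup in
theorem frobNorm_add_le {d k : ℕ} (M M' : Matrix (Fin d) (Fin k) ℝ) :
    frobNorm (M + M') ≤ frobNorm M + frobNorm M' := by
  have h : ∀ A : Matrix (Fin d) (Fin k) ℝ, frobNorm A = ‖A‖ := fun A => by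
    rw [Matrix.frobenius_norm_def, frobNorm, Real.sqrt_eq_rpow]
    simp
  simpa only [h] using norm_add_le M M'

theorem frobNorm_smul {d k : ℕ} (c : ℝ) (M : Matrix (Fin d) (Fin k) ℝ) :
    frobNorm (c • M) = |c| * frobNorm M := by
  rw [frobNorm, frobNorm, ← Real.sqrt_sq_eq_abs, ← Real.sqrt_mul (sq_nonneg c)]
  simp [Finset.mul_sum, mul_pow]

theorem frobNorm_sub_comm {d k : ℕ} (M M' : Matrix (Fin d) (Fin k) ℝ) :
    frobNorm (M - M') = frobNorm (M' - M) := by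
  rw [← neg_sub, ← neg_one_smul ℝ, frobNorm_smul]
  simp

theorem frobNorm_sq_eq_trace {d k : ℕ} (M : Matrix (Fin d) (Fin k) ℝ) :
    frobNorm M ^ 2 = (M.transpose * M).trace := by
  rw [frobNorm_sq, Finset.sum_comm]
  simp [Matrix.trace, Matrix.mul_apply, sq]

theorem frobNorm_sq_eq_sum_colNorm_sq {d k : ℕ} (M : Matrix (Fin d) (Fin k) ℝ) :
    frobNorm M ^ 2 = ∑ m, colNorm M m ^ 2 := by
  rw [frobNorm_sq, Finset.sum_comm]
  exact Finset.sum_congr rfl fun m _ =>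
    (Real.sq_sqrt (Finset.sum_nonneg fun _ _ => sq_nonneg _)).symm

/-- The bias and deviation estimates are relative errors per column; summing their squares costs no
factor of `k`. -/
theorem frobNorm_le_of_colNorm_le {d k : ℕ} {M M' : Matrix (Fin d) (Fin k) ℝ} {c : ℝ}
    (hc : 0 ≤ c) (h : ∀ m, colNorm M m ≤ c * colNorm M' m) :
    frobNorm M ≤ c * frobNorm M' := by
  refine (sq_le_sq₀ (frobNorm_nonneg _) (mul_nonneg hc (frobNorm_nonneg _))).1 ?_
  rw [mul_pow, frobNorm_sq_eq_sum_colNorm_sq, frobNorm_sq_eq_sum_colNorm_sq, Finset.mul_sum]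
  refine Finset.sum_le_sum fun m _ => ?_
  rw [← mul_pow]
  exact pow_le_pow_left₀ (Real.sqrt_nonneg _) (h m) 2

theorem frobNorm_orthogonal_mul_mul {d k : ℕ} {U : Matrix (Fin d) (Fin d) ℝ}
    {V : Matrix (Fin k) (Fin k) ℝ} (hU : U ∈ Matrix.orthogonalGroup (Fin d) ℝ)
    (hV : V ∈ Matrix.orthogonalGroup (Fin k) ℝ) (M : Matrix (Fin d) (Fin k) ℝ) :
    frobNorm (U * M * V.transpose) = frobNorm M := by
  have hU' : U.transpose * U = 1 := (Matrix.mem_orthogonalGroup_iff' _ _).1 hU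
  have hV' : V.transpose * V = 1 := (Matrix.mem_orthogonalGroup_iff' _ _).1 hV
  refine (sq_eq_sq₀ (frobNorm_nonneg _) (frobNorm_nonneg _)).1 ?_
  rw [frobNorm_sq_eq_trace, frobNorm_sq_eq_trace]
  calc ((U * M * V.transpose).transpose * (U * M * V.transpose)).trace
      = (V * (M.transpose * (U.transpose * U) * M * V.transpose)).trace := by
        simp only [Matrix.transpose_mul, Matrix.transpose_transpose, Matrix.mul_assoc]
    _ = (M.transpose * M * (V.transpose * V)).trace := by
        rw [hU', Matrix.trace_mul_comm]
        simp only [Matrix.mul_assoc, Matrix.one_mul]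
    _ = _ := by rw [hV', Matrix.mul_one]

theorem sum_le_sum_of_nonneg_of_ne_zero {ι : Type*} {s t : Finset ι} {f : ι → ℝ}
    (hf : ∀ i, 0 ≤ f i) (h : ∀ i ∈ s, f i ≠ 0 → i ∈ t) : ∑ i ∈ s, f i ≤ ∑ i ∈ t, f i := by
  classical
  rw [← Finset.sum_filter_ne_zero]
  refine Finset.sum_le_sum_of_subset_of_nonneg (fun i hi => ?_) fun i _ _ => hf i
  rw [Finset.mem_filter] at hi
  exact h i hi.1 hi.2

/-- The Frobenius norm is at most the square root of the rank times the top singular value. -/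
theorem frobNorm_le_sqrt_rank_mul {d k : ℕ} (M : Matrix (Fin d) (Fin k) ℝ) :
    frobNorm M ≤ Real.sqrt M.rank * singularValue M 1 := by
  set T := Matrix.toEuclideanLin M with hT
  have hk : Module.finrank ℝ (EuclideanSpace ℝ (Fin k)) = k := by simp
  have hrank : Module.finrank ℝ (LinearMap.range T) = M.rank :=
    (Matrix.rank_eq_finrank_range_toLin M (EuclideanSpace.basisFun _ ℝ).toBasis
      (EuclideanSpace.basisFun _ ℝ).toBasis).symm
  have h0 : ∀ i, 0 ≤ T.singularValues i := T.singularValues_nonneg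
  -- Both sides are the trace of `T* T`, computed in the standard basis and in an eigenbasis.
  have hsum : frobNorm M ^ 2 = ∑ i : Fin k, T.singularValues i ^ 2 := by
    have h1 := T.isSymmetric_adjoint_comp_self.trace_eq_sum_eigenvalues hk
    rw [LinearMap.trace_eq_sum_inner _ (EuclideanSpace.basisFun (Fin k) ℝ)] at h1
    simp only [T.sq_singularValues_fin hk]
    refine Eq.trans ?_ h1
    rw [frobNorm_sq, Finset.sum_comm]
    refine Finset.sum_congr rfl fun j _ => ?_
    rw [LinearMap.comp_apply, LinearMap.adjoint_inner_right, real_inner_self_eq_norm_sq,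
      EuclideanSpace.norm_sq_eq]
    simp [hT, Matrix.toLpLin_apply]
  have hle : ∑ i : Fin k, T.singularValues i ^ 2 ≤ M.rank * T.singularValues 0 ^ 2 := by
    rw [Fin.sum_univ_eq_sum_range (fun i => T.singularValues i ^ 2)]
    calc ∑ i ∈ Finset.range k, T.singularValues i ^ 2
        ≤ ∑ i ∈ Finset.range M.rank, T.singularValues i ^ 2 := by
          refine sum_le_sum_of_nonneg_of_ne_zero (fun _ => sq_nonneg _) fun i _ hi => ?_
          rw [← hrank, ← T.support_singularValues, Finsupp.mem_support_iff]
          exact fun h => hi (by rw [h]; simp)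
      _ ≤ ∑ i ∈ Finset.range M.rank, T.singularValues 0 ^ 2 :=
          Finset.sum_le_sum fun i _ =>
            pow_le_pow_left₀ (h0 i) (T.singularValues_antitone (Nat.zero_le i)) 2
      _ = _ := by simp
  have hnn : 0 ≤ singularValue M 1 := h0 0
  refine (sq_le_sq₀ (frobNorm_nonneg _) (mul_nonneg (Real.sqrt_nonneg _) hnn)).1 ?_
  rw [mul_pow, Real.sq_sqrt (Nat.cast_nonneg _), hsum]
  exact hle

theorem singularValue_rank_pos {d k : ℕ} {M : Matrix (Fin d) (Fin k) ℝ} (h : 1 ≤ M.rank) :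
    0 < singularValue M M.rank := by
  have hrank : Module.finrank ℝ (LinearMap.range (Matrix.toEuclideanLin M)) = M.rank :=
    (Matrix.rank_eq_finrank_range_toLin M (EuclideanSpace.basisFun _ ℝ).toBasis
      (EuclideanSpace.basisFun _ ℝ).toBasis).symm
  -- The underlying index is `M.rank - 1`, a natural subtraction, so it is below the rank only
  -- because the rank is at least 1.
  refine (LinearMap.singularValues_pos_iff_lt_finrank_range _).2 ?_
  omega

theorem one_le_condNumber {d k : ℕ} {M : Matrix (Fin d) (Fin k) ℝ} (h : 1 ≤ M.rank) :
    1 ≤ condNumber M := by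
  rw [condNumber, one_le_div (singularValue_rank_pos h)]
  exact LinearMap.singularValues_antitone _ (by omega)

/-! ### Truncated singular value decompositions -/

/-- Keep the first `r` diagonal entries. -/
def truncDiag {n : ℕ} (r : ℕ) (s : Fin n → ℝ) : Fin n → ℝ := fun i =>
  if (i : ℕ) < r then s i else 0

theorem rectDiagonal_sub {d k : ℕ} (s t : Fin (min d k) → ℝ) :
    rectDiagonal (s - t) = rectDiagonal s - rectDiagonal t := by
  ext i j
  simp only [rectDiagonal, Matrix.of_apply, Matrix.sub_apply, Pi.sub_apply]
  split_ifs <;> simp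

theorem frobNorm_sq_rectDiagonal_le {d k : ℕ} (t : Fin (min d k) → ℝ) :
    frobNorm (rectDiagonal t) ^ 2 ≤ ∑ l, t l ^ 2 := by
  set τ : ℕ → ℝ := fun n => if h : n < min d k then t ⟨n, h⟩ ^ 2 else 0 with hτ
  have h1 : ∑ l, t l ^ 2 = ∑ n ∈ Finset.range (min d k), τ n := by
    rw [← Fin.sum_univ_eq_sum_range]
    exact Finset.sum_congr rfl fun l _ => by simp only [hτ]; rw [dif_pos l.isLt]
  rw [h1, frobNorm_sq]
  have h2 : ∀ i : Fin d, ∑ j : Fin k, rectDiagonal t i j ^ 2 = τ i := by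
    intro i
    by_cases hi : (i : ℕ) < k
    · rw [Finset.sum_eq_single ⟨i, hi⟩]
      · simp [rectDiagonal, hτ, hi]
      · intro j _ hj
        have : (i : ℕ) ≠ j := fun h => hj (Fin.ext h.symm)
        simp [rectDiagonal, this]
      · simp
    · rw [Finset.sum_eq_zero]
      · simp [hτ, hi]
      · intro j _
        have : (i : ℕ) ≠ j := fun h => hi (h ▸ j.isLt)
        simp [rectDiagonal, this]
  simp only [h2]
  rw [Fin.sum_univ_eq_sum_range]
  refine sum_le_sum_of_nonneg_of_ne_zero
    (fun n => by simp only [hτ]; split_ifs <;> positivity) fun n _ hn => ?_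
  by_contra hc
  exact hn (dif_neg (by simpa using hc))

/-- Weights in `[0, 1]` of total mass at most `r` capture at most the sum of the `r` largest
values. -/
theorem sum_tail_le_sum_mul_one_sub {n r : ℕ} (hr : r < n) (a p : Fin n → ℝ) (ha : Antitone a)
    (ha0 : ∀ i, 0 ≤ a i) (hp0 : ∀ i, 0 ≤ p i) (hp1 : ∀ i, p i ≤ 1) (hp : ∑ i, p i ≤ r) :
    ∑ i : Fin n, (if (i : ℕ) < r then 0 else a i) ≤ ∑ i, a i * (1 - p i) := by
  set b := a ⟨r, hr⟩
  have hcard : ∑ i : Fin n, (if (i : ℕ) < r then (1 : ℝ) else 0) = r := by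
    rw [Fin.sum_univ_eq_sum_range (fun i => if i < r then (1 : ℝ) else 0), ← Finset.sum_filter]
    have : Finset.filter (fun i => i < r) (Finset.range n) = Finset.range r := by
      ext i; simp; omega
    rw [this]; simp
  -- The value `b = a r` is a threshold: it lies below the values with `i < r` and above the others.
  -- Summed over `i`, the left side is `b * (r - ∑ p)`, which is nonnegative.
  have key : ∀ i : Fin n, b * ((if (i : ℕ) < r then (1 : ℝ) else 0) - p i) ≤
      a i * (1 - p i) - (if (i : ℕ) < r then 0 else a i) := by
    intro i
    split_ifs with h
    · have : b ≤ a i := ha (show i ≤ ⟨r, hr⟩ from h.le)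
      nlinarith [hp1 i]
    · have : a i ≤ b := ha (show (⟨r, hr⟩ : Fin n) ≤ i from not_lt.1 h)
      nlinarith [hp0 i]
  have h2 := Finset.sum_le_sum fun i (_ : i ∈ Finset.univ) => key i
  rw [← Finset.mul_sum, Finset.sum_sub_distrib, Finset.sum_sub_distrib, hcard] at h2
  nlinarith [ha0 ⟨r, hr⟩]

/-- Eckart–Young for diagonal matrices: truncation is an optimal low-rank approximation. -/
theorem frobNorm_rectDiagonal_sub_trunc_le {d k r : ℕ} (hr : r < min d k)
    (s : Fin (min d k) → ℝ) (hs0 : ∀ i, 0 ≤ s i) (hs : Antitone s)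
    (B : Matrix (Fin d) (Fin k) ℝ) (hB : B.rank ≤ r) :
    frobNorm (rectDiagonal s - rectDiagonal (truncDiag r s)) ≤ frobNorm (rectDiagonal s - B) := by
  set T := Matrix.toEuclideanLin B with hT
  set R := LinearMap.range T with hR
  have hrank : Module.finrank ℝ R = B.rank :=
    (Matrix.rank_eq_finrank_range_toLin B (EuclideanSpace.basisFun _ ℝ).toBasis
      (EuclideanSpace.basisFun _ ℝ).toBasis).symm
  set e := EuclideanSpace.basisFun (Fin d) ℝ with he
  -- The columns of `B` lie in `R`, so column `l` misses `s l • e l` by at least `s l ^ 2 * (1 - p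
  -- l)` in squared norm. The weights `p` lie in `[0, 1]` and sum to the rank of `B`, which reduces
  -- the claim to `sum_tail_le_sum_mul_one_sub`.
  set p : Fin d → ℝ := fun i => ‖R.starProjection (e i)‖ ^ 2 with hp
  have hpy : ∀ x : EuclideanSpace ℝ (Fin d),
      ‖x - R.starProjection x‖ ^ 2 = ‖x‖ ^ 2 - ‖R.starProjection x‖ ^ 2 := by
    intro x
    have h := R.norm_sq_eq_add_norm_sq_starProjection x
    rw [Submodule.starProjection_orthogonal_val] at h
    linarith
  have hp1 : ∀ i, p i ≤ 1 := fun i => by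
    have := hpy (e i)
    rw [e.orthonormal.1 i] at this
    nlinarith [sq_nonneg ‖e i - R.starProjection (e i)‖]
  have hpsum : ∑ i, p i = B.rank := by
    set f := stdOrthonormalBasis ℝ R
    have h1 : ∀ i, p i = ∑ a, (inner ℝ ((f a : R) : EuclideanSpace ℝ (Fin d)) (e i)) ^ 2 := by
      intro i
      rw [hp]
      simp only [Submodule.starProjection_apply]
      rw [← Submodule.coe_norm, ← f.sum_sq_norm_inner_right]
      refine Finset.sum_congr rfl fun a _ => ?_
      rw [Submodule.inner_orthogonalProjectionOnto_eq_of_mem_left, Real.norm_eq_abs, sq_abs]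
    simp only [h1]
    rw [Finset.sum_comm]
    have h2 : ∀ a, ∑ i, (inner ℝ ((f a : R) : EuclideanSpace ℝ (Fin d)) (e i)) ^ 2 = 1 := by
      intro a
      have := e.sum_sq_norm_inner_left ((f a : R) : EuclideanSpace ℝ (Fin d))
      simp only [Real.norm_eq_abs, sq_abs] at this
      rw [this, ← Submodule.coe_norm, f.orthonormal.1 a, one_pow]
    simp [h2, hrank]
  have hcol : ∀ l : Fin (min d k), s l ^ 2 * (1 - p (Fin.castLE (min_le_left d k) l)) ≤
      ∑ i, (rectDiagonal s - B) i (Fin.castLE (min_le_right d k) l) ^ 2 := by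
    intro l
    set x := s l • e (Fin.castLE (min_le_left d k) l) with hx
    set y : EuclideanSpace ℝ (Fin d) :=
      T (EuclideanSpace.basisFun (Fin k) ℝ (Fin.castLE (min_le_right d k) l)) with hy
    have hyR : y ∈ R := LinearMap.mem_range_self _ _
    have h1 : ∑ i, (rectDiagonal s - B) i (Fin.castLE (min_le_right d k) l) ^ 2 = ‖x - y‖ ^ 2 := by
      rw [EuclideanSpace.norm_sq_eq]
      refine Finset.sum_congr rfl fun i _ => ?_
      rw [Real.norm_eq_abs, sq_abs]
      congr 1
      have h2 : y i = B i (Fin.castLE (min_le_right d k) l) := by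
        simp [hy, hT, Matrix.toLpLin_apply]
      rw [Matrix.sub_apply, PiLp.sub_apply, h2]
      congr 1
      by_cases hil : (i : ℕ) = l
      · have : i = Fin.castLE (min_le_left d k) l := Fin.ext hil
        subst this
        simp [rectDiagonal, hx, he]
      · have : i ≠ Fin.castLE (min_le_left d k) l := fun h => hil (congrArg Fin.val h)
        simp [rectDiagonal, hx, he, hil, this]
    rw [h1]
    have h3 : ‖x - R.starProjection x‖ ≤ ‖x - y‖ := by
      rw [Submodule.starProjection_minimal]
      exact ciInf_le ⟨0, by rintro _ ⟨z, rfl⟩; exact norm_nonneg _⟩ (⟨y, hyR⟩ : R)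
    have h4 := hpy x
    rw [hx, map_smul, norm_smul, norm_smul, e.orthonormal.1] at h4
    calc _ = ‖x - R.starProjection x‖ ^ 2 := by
          rw [hx, map_smul, h4, Real.norm_eq_abs, mul_pow, mul_pow, sq_abs, hp]; ring
      _ ≤ _ := pow_le_pow_left₀ (norm_nonneg _) h3 2
  have hle : ∑ l : Fin (min d k), ∑ i, (rectDiagonal s - B) i (Fin.castLE (min_le_right d k) l) ^ 2
      ≤ frobNorm (rectDiagonal s - B) ^ 2 := by
    rw [frobNorm_sq, Finset.sum_comm (s := (Finset.univ : Finset (Fin d)))]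
    have := Finset.sum_le_univ_sum_of_nonneg (f := fun j => ∑ i, (rectDiagonal s - B) i j ^ 2)
      (s := Finset.univ.map (Fin.castLEEmb (min_le_right d k)))
      (fun j => Finset.sum_nonneg fun _ _ => sq_nonneg _)
    rw [Finset.sum_map] at this
    exact this
  have hple : ∑ l : Fin (min d k), p (Fin.castLE (min_le_left d k) l) ≤ r := by
    have := Finset.sum_le_univ_sum_of_nonneg (f := p)
      (s := Finset.univ.map (Fin.castLEEmb (min_le_left d k))) (fun j => sq_nonneg _)
    rw [Finset.sum_map, hpsum] at this
    exact this.trans (by exact_mod_cast hB)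
  have htail := sum_tail_le_sum_mul_one_sub hr (fun l => s l ^ 2)
    (fun l => p (Fin.castLE (min_le_left d k) l))
    (fun i j hij => pow_le_pow_left₀ (hs0 j) (hs hij) 2) (fun _ => sq_nonneg _)
    (fun _ => sq_nonneg _) (fun _ => hp1 _) hple
  refine (sq_le_sq₀ (frobNorm_nonneg _) (frobNorm_nonneg _)).1 ?_
  calc frobNorm (rectDiagonal s - rectDiagonal (truncDiag r s)) ^ 2
      ≤ ∑ l, (s - truncDiag r s) l ^ 2 := by
        rw [← rectDiagonal_sub]; exact frobNorm_sq_rectDiagonal_le _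
    _ = ∑ l : Fin (min d k), (if (l : ℕ) < r then 0 else s l ^ 2) := by
        refine Finset.sum_congr rfl fun l _ => ?_
        simp only [Pi.sub_apply, truncDiag]
        split_ifs <;> simp
    _ ≤ _ := htail.trans ((Finset.sum_le_sum fun l _ => hcol l).trans hle)

/-- The two square roots of `S` recombine, so the product of the factors is `γ` times the truncated
decomposition. -/
theorem IsSpectralInit.mul_eq {d k r : ℕ} {γ : ℝ} (hγ : 0 ≤ γ) (hr : r ≤ min d k)
    {U : Matrix (Fin d) (Fin d) ℝ} {s : Fin (min d k) → ℝ} {V : Matrix (Fin k) (Fin k) ℝ}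
    (hs : ∀ i, 0 ≤ s i) :
    (Real.sqrt γ • (U.submatrix id (Fin.castLE (hr.trans (min_le_left d k))) *
      Matrix.diagonal fun l => Real.sqrt (s (Fin.castLE hr l)))) *
    (Real.sqrt γ • ((Matrix.diagonal fun l => Real.sqrt (s (Fin.castLE hr l))) *
      (V.submatrix id (Fin.castLE (hr.trans (min_le_right d k)))).transpose)) =
    γ • (U * rectDiagonal (truncDiag r s) * V.transpose) := by
  rw [Matrix.smul_mul, Matrix.mul_smul, smul_smul, Real.mul_self_sqrt hγ]
  congr 1
  rw [← Matrix.mul_assoc, Matrix.mul_assoc (U.submatrix _ _), Matrix.diagonal_mul_diagonal]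
  simp only [Real.mul_self_sqrt (hs _)]
  have hUS : U * rectDiagonal (truncDiag r s) = Matrix.of fun (i : Fin d) (j : Fin k) =>
      if h : (j : ℕ) < r then U i ⟨j, h.trans_le (hr.trans (min_le_left d k))⟩ *
        s ⟨j, h.trans_le hr⟩ else 0 := by
    ext i j
    rw [Matrix.mul_apply, Matrix.of_apply]
    split_ifs with h
    · rw [Finset.sum_eq_single ⟨j, h.trans_le (hr.trans (min_le_left d k))⟩]
      · simp [rectDiagonal, truncDiag, h]
      · intro b _ hb
        have : (b : ℕ) ≠ j := fun hbj => hb (Fin.ext hbj)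
        simp [rectDiagonal, this]
      · simp
    · refine Finset.sum_eq_zero fun b _ => ?_
      by_cases hb : (b : ℕ) = j
      · simp [rectDiagonal, truncDiag, hb, h]
      · simp [rectDiagonal, hb]
  rw [hUS]
  ext i m
  simp only [Matrix.mul_apply, Matrix.of_apply, Matrix.transpose_apply, Matrix.submatrix_apply,
    id]
  set f : ℕ → ℝ := fun n => if h : n < r then U i ⟨n, h.trans_le (hr.trans (min_le_left d k))⟩ *
        s ⟨n, h.trans_le hr⟩ * V m ⟨n, h.trans_le (hr.trans (min_le_right d k))⟩ else 0 with hf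
  have h1 : ∀ j : Fin k, (if h : (j : ℕ) < r then
      U i ⟨j, h.trans_le (hr.trans (min_le_left d k))⟩ * s ⟨j, h.trans_le hr⟩ else 0) * V m j
      = f j := by
    intro j
    simp only [hf]
    split_ifs <;> simp
  have h2 : ∀ l : Fin r, (∑ x : Fin r, U i (Fin.castLE (hr.trans (min_le_left d k)) x) *
      Matrix.diagonal (fun l => s (Fin.castLE hr l)) x l) *
      V m (Fin.castLE (hr.trans (min_le_right d k)) l) = f l := by
    intro l
    simp only [hf, l.isLt, dif_pos, Matrix.diagonal_apply]
    simp
    rfl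
  simp only [h1, h2]
  rw [Fin.sum_univ_eq_sum_range f, Fin.sum_univ_eq_sum_range f]
  refine Finset.sum_subset (Finset.range_mono (hr.trans (min_le_right d k))) fun n _ hn => ?_
  exact dif_neg (by simpa using hn)

/-- The spectral initialization with `γ = 2` from a matrix near half of a rank-`r` matrix
approximately recovers this matrix. -/
theorem IsSpectralInit.frobNorm_mul_sub_le {d k r : ℕ} (hr : r < min d k)
    {G Δ : Matrix (Fin d) (Fin k) ℝ} (hΔ : Δ.rank ≤ r) {A : Matrix (Fin d) (Fin r) ℝ}
    {B : Matrix (Fin r) (Fin k) ℝ} (h : IsSpectralInit 2 hr.le G A B) :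
    frobNorm (A * B - Δ) ≤ 4 * frobNorm (G - (1 / 2 : ℝ) • Δ) := by
  obtain ⟨U, s, V, hG, rfl, rfl⟩ := h
  rw [IsSpectralInit.mul_eq (by norm_num) hr.le hG.nonneg]
  set H := U * rectDiagonal (truncDiag r s) * V.transpose with hH
  set Δ' := (1 / 2 : ℝ) • Δ with hΔ'
  have hU : U * U.transpose = 1 := (Matrix.mem_orthogonalGroup_iff _ _).1 hG.left_orthogonal
  have hV : V * V.transpose = 1 := (Matrix.mem_orthogonalGroup_iff _ _).1 hG.right_orthogonal
  have hB : U * (U.transpose * Δ' * V) * V.transpose = Δ' := by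
    calc _ = (U * U.transpose) * Δ' * (V * V.transpose) := by simp only [Matrix.mul_assoc]
      _ = Δ' := by rw [hU, hV, Matrix.one_mul, Matrix.mul_one]
  have hrank : (U.transpose * Δ' * V).rank ≤ r := by
    refine (Matrix.rank_mul_le_left _ _).trans ((Matrix.rank_mul_le_right _ _).trans ?_)
    have : Δ' = Δ * ((1 / 2 : ℝ) • (1 : Matrix (Fin k) (Fin k) ℝ)) := by
      rw [Matrix.mul_smul, Matrix.mul_one]
    rw [this]
    exact (Matrix.rank_mul_le_left _ _).trans hΔ
  -- `Δ'` has rank at most `r`, so it cannot beat the truncation `H`. The triangle inequality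
  -- through `G` gives a factor 2, and `γ = 2` gives another.
  have h1 : frobNorm (G - H) ≤ frobNorm (G - Δ') := by
    have e1 : G - H = U * (rectDiagonal s - rectDiagonal (truncDiag r s)) * V.transpose := by
      rw [hG.eq_mul, hH, Matrix.mul_sub, Matrix.sub_mul]
    have e2 : G - Δ' = U * (rectDiagonal s - U.transpose * Δ' * V) * V.transpose := by
      rw [Matrix.mul_sub, Matrix.sub_mul, hB, ← hG.eq_mul]
    rw [e1, e2, frobNorm_orthogonal_mul_mul hG.left_orthogonal hG.right_orthogonal,
      frobNorm_orthogonal_mul_mul hG.left_orthogonal hG.right_orthogonal]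
    exact frobNorm_rectDiagonal_sub_trunc_le hr s hG.nonneg hG.antitone _ hrank
  have e3 : (2 : ℝ) • H - Δ = (2 : ℝ) • ((H - G) + (G - Δ')) := by
    rw [sub_add_sub_cancel, smul_sub, hΔ', smul_smul]; norm_num
  rw [e3, frobNorm_smul, abs_of_pos two_pos]
  have h2 := frobNorm_add_le (H - G) (G - Δ')
  rw [frobNorm_sub_comm H G] at h2
  linarith

/-! ### Moments of the standard Gaussian measure -/

/-- For unit `n` this is self-adjointness of the projection onto the complement of `n`. -/
theorem inner_sub_inner_smul {V : Type*} [NormedAddCommGroup V] [InnerProductSpace ℝ V]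
    (n u x : V) :
    inner ℝ u (x - inner ℝ n x • n) = inner ℝ (u - inner ℝ n u • n) x := by
  rw [inner_sub_right, inner_sub_left, real_inner_smul_left, real_inner_smul_right,
    real_inner_comm n u]
  ring

section Gaussian

variable {E : Type*} [NormedAddCommGroup E] [InnerProductSpace ℝ E] [FiniteDimensional ℝ E]
  [MeasurableSpace E] [BorelSpace E]

theorem hasLaw_inner_stdGaussian {u : E} (hu : ‖u‖ = 1) :
    HasLaw (fun x => inner ℝ u x) (gaussianReal 0 1) (stdGaussian E) where
  aemeasurable := by fun_prop
  map_eq := by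
    have h := IsGaussian.map_eq_gaussianReal (μ := stdGaussian E) (innerSL ℝ u)
    rw [integral_strongDual_stdGaussian, variance_dual_stdGaussian, innerSL_apply_norm, hu] at h
    simpa using h

theorem memLp_inner_stdGaussian (u : E) (p : ENNReal) (hp : p ≠ ⊤) :
    MemLp (fun x => inner ℝ u x) p (stdGaussian E) :=
  IsGaussian.memLp_dual (stdGaussian E) (innerSL ℝ u) p hp

theorem integrable_inner_mul_inner (u v : E) :
    Integrable (fun x => inner ℝ u x * inner ℝ v x) (stdGaussian E) :=
  (memLp_inner_stdGaussian u 2 (by simp)).integrable_mul (memLp_inner_stdGaussian v 2 (by simp))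

theorem integral_inner_stdGaussian (u : E) : ∫ x, inner ℝ u x ∂(stdGaussian E) = 0 :=
  integral_strongDual_stdGaussian (innerSL ℝ u)

theorem integral_inner_mul_inner (u v : E) :
    ∫ x, inner ℝ u x * inner ℝ v x ∂(stdGaussian E) = inner ℝ u v := by
  have h : covarianceBilin (stdGaussian E) u v = inner ℝ u v := by
    rw [covarianceBilin_stdGaussian]; rfl
  rw [covarianceBilin_apply_eq_cov IsGaussian.memLp_two_id] at h
  rw [← h, covariance_eq_sub (memLp_inner_stdGaussian u 2 (by simp))
    (memLp_inner_stdGaussian v 2 (by simp)), integral_inner_stdGaussian]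
  simp

/-- All later moment and tail constants come from this one value; the exponent `1/4` stays below the
critical `1/2`. -/
theorem integrable_exp_sq_gaussianReal :
    Integrable (fun t : ℝ => Real.exp (t ^ 2 / 4)) (gaussianReal 0 1) ∧
      ∫ t, Real.exp (t ^ 2 / 4) ∂(gaussianReal 0 1) = Real.sqrt 2 := by
  have hpdf : ∀ t : ℝ, gaussianPDFReal 0 1 t * Real.exp (t ^ 2 / 4) =
      (Real.sqrt (2 * Real.pi))⁻¹ * Real.exp (-(1 / 4) * t ^ 2) := by
    intro t
    rw [gaussianPDFReal, mul_assoc, ← Real.exp_add]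
    congr 2
    · simp
    · simp; ring
  have hint : Integrable (fun t : ℝ => (Real.sqrt (2 * Real.pi))⁻¹ *
      Real.exp (-(1 / 4) * t ^ 2)) := (integrable_exp_neg_mul_sq (by norm_num)).const_mul _
  constructor
  · rw [gaussianReal_of_var_ne_zero 0 one_ne_zero,
      integrable_withDensity_iff_integrable_smul' (measurable_gaussianPDF 0 1)
        (Filter.Eventually.of_forall fun _ => gaussianPDF_lt_top)]
    refine hint.congr (Filter.Eventually.of_forall fun t => ?_)
    simp only [toReal_gaussianPDF, smul_eq_mul, hpdf]
  · rw [integral_gaussianReal_eq_integral_smul one_ne_zero]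
    simp only [smul_eq_mul, hpdf]
    rw [integral_const_mul, integral_gaussian, ← Real.sqrt_inv, ← Real.sqrt_mul (by positivity)]
    congr 1
    field_simp
    norm_num

theorem integrable_exp_inner_sq {u : E} (hu : ‖u‖ = 1) :
    Integrable (fun x => Real.exp ((inner ℝ u x) ^ 2 / 4)) (stdGaussian E) := by
  have h := integrable_exp_sq_gaussianReal.1
  rw [← (hasLaw_inner_stdGaussian hu).map_eq] at h
  exact h.comp_aemeasurable (hasLaw_inner_stdGaussian hu).aemeasurable

theorem integral_exp_inner_sq {u : E} (hu : ‖u‖ = 1) :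
    ∫ x, Real.exp ((inner ℝ u x) ^ 2 / 4) ∂(stdGaussian E) = Real.sqrt 2 := by
  rw [← integrable_exp_sq_gaussianReal.2]
  exact (hasLaw_inner_stdGaussian hu).integral_comp
    (f := fun t : ℝ => Real.exp (t ^ 2 / 4)) integrable_exp_sq_gaussianReal.1.aestronglyMeasurable

/-- Use `u ^ 2 / 2 ≤ exp u` at `u = t ^ 2 / 4`. -/
theorem pow_four_le_exp (t : ℝ) : t ^ 4 ≤ 32 * Real.exp (t ^ 2 / 4) := by
  have := Real.quadratic_le_exp_of_nonneg (x := t ^ 2 / 4) (by positivity)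
  nlinarith [sq_nonneg t]

theorem sqrt_two_le : Real.sqrt 2 ≤ 3 / 2 := by
  rw [Real.sqrt_le_left (by norm_num)]; norm_num

theorem integrable_inner_pow_four (u : E) :
    Integrable (fun x => (inner ℝ u x) ^ 4) (stdGaussian E) := by
  have h := (memLp_inner_stdGaussian u 4 (by simp)).integrable_norm_pow (by norm_num)
  refine h.congr (Filter.Eventually.of_forall fun x => ?_)
  simp only [Real.norm_eq_abs]
  exact Even.pow_abs (by decide) _

theorem integral_inner_pow_four_le {u : E} (hu : ‖u‖ = 1) :
    ∫ x, (inner ℝ u x) ^ 4 ∂(stdGaussian E) ≤ 48 := by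
  calc ∫ x, (inner ℝ u x) ^ 4 ∂(stdGaussian E)
      ≤ ∫ x, 32 * Real.exp ((inner ℝ u x) ^ 2 / 4) ∂(stdGaussian E) :=
        integral_mono (integrable_inner_pow_four u) ((integrable_exp_inner_sq hu).const_mul _)
          fun x => pow_four_le_exp _
    _ ≤ 48 := by
        rw [integral_const_mul, integral_exp_inner_sq hu]
        linarith [sqrt_two_le]

theorem integrable_abs_inner_mul_sq (u v : E) :
    Integrable (fun x => |inner ℝ u x| * (inner ℝ v x) ^ 2) (stdGaussian E) := by
  have h : MemLp (fun x => (inner ℝ v x) ^ 2) 2 (stdGaussian E) := by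
    refine (memLp_two_iff_integrable_sq (by fun_prop)).2 ?_
    simpa only [← pow_mul] using integrable_inner_pow_four v
  exact (memLp_inner_stdGaussian u 2 (by simp)).abs.integrable_mul h

/-- After normalizing, `|p| q² ≤ (p² + q⁴) / 2`, and the moments 1 and at most 48 give `49 / 2`. -/
theorem integral_abs_inner_mul_sq_le (u v : E) :
    ∫ x, |inner ℝ u x| * (inner ℝ v x) ^ 2 ∂(stdGaussian E) ≤ 49 / 2 * (‖u‖ * ‖v‖ ^ 2) := by
  rcases eq_or_ne u 0 with rfl | hu
  · simp
  rcases eq_or_ne v 0 with rfl | hv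
  · simp
  have hu' : ‖u‖ ≠ 0 := norm_ne_zero_iff.2 hu
  have hv' : ‖v‖ ≠ 0 := norm_ne_zero_iff.2 hv
  set u' := ‖u‖⁻¹ • u with hu'def
  set v' := ‖v‖⁻¹ • v with hv'def
  have hu1 : ‖u'‖ = 1 := norm_smul_inv_norm hu
  have hv1 : ‖v'‖ = 1 := norm_smul_inv_norm hv
  have heq : ∀ x : E, |inner ℝ u x| * (inner ℝ v x) ^ 2 =
      ‖u‖ * ‖v‖ ^ 2 * (|inner ℝ u' x| * (inner ℝ v' x) ^ 2) := by
    intro x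
    rw [hu'def, hv'def, real_inner_smul_left, real_inner_smul_left, abs_mul, abs_inv, abs_norm]
    field_simp
  simp only [heq]
  rw [integral_const_mul, mul_comm (49 / 2 : ℝ)]
  refine mul_le_mul_of_nonneg_left ?_ (by positivity)
  have hI2 := integrable_inner_mul_inner u' u'
  calc ∫ x, |inner ℝ u' x| * (inner ℝ v' x) ^ 2 ∂(stdGaussian E)
      ≤ ∫ x, (1 / 2 : ℝ) * (inner ℝ u' x * inner ℝ u' x + (inner ℝ v' x) ^ 4) ∂(stdGaussian E) := by
        refine integral_mono (integrable_abs_inner_mul_sq u' v')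
          ((hI2.add (integrable_inner_pow_four v')).const_mul _) fun x => ?_
        have := sq_nonneg (|inner ℝ u' x| - (inner ℝ v' x) ^ 2)
        have h2 := abs_mul_abs_self (inner ℝ u' x)
        nlinarith
    _ ≤ 49 / 2 := by
        rw [integral_const_mul, integral_add hI2 (integrable_inner_pow_four v'),
          integral_inner_mul_inner, real_inner_self_eq_norm_sq, hu1]
        linarith [integral_inner_pow_four_le hv1]

theorem integrable_abs_inner_mul_abs_inner (u v : E) :
    Integrable (fun x => |inner ℝ u x| * |inner ℝ v x|) (stdGaussian E) :=
  (memLp_inner_stdGaussian u 2 (by simp)).abs.integrable_mul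
    (memLp_inner_stdGaussian v 2 (by simp)).abs

theorem integral_abs_inner_mul_abs_inner_le (u v : E) :
    ∫ x, |inner ℝ u x| * |inner ℝ v x| ∂(stdGaussian E) ≤ ‖u‖ * ‖v‖ := by
  rcases eq_or_ne u 0 with rfl | hu
  · simp
  rcases eq_or_ne v 0 with rfl | hv
  · simp
  have hu' : 0 < ‖u‖ := norm_pos_iff.2 hu
  have hv' : 0 < ‖v‖ := norm_pos_iff.2 hv
  have hIu := integrable_inner_mul_inner u u
  have hIv := integrable_inner_mul_inner v v
  calc ∫ x, |inner ℝ u x| * |inner ℝ v x| ∂(stdGaussian E)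
      ≤ ∫ x, ((‖v‖ / (2 * ‖u‖)) * (inner ℝ u x * inner ℝ u x) +
          (‖u‖ / (2 * ‖v‖)) * (inner ℝ v x * inner ℝ v x)) ∂(stdGaussian E) := by
        refine integral_mono (integrable_abs_inner_mul_abs_inner u v)
          ((hIu.const_mul _).add (hIv.const_mul _)) fun x => ?_
        have := sq_nonneg (‖v‖ * |inner ℝ u x| - ‖u‖ * |inner ℝ v x|)
        have h1 := abs_mul_abs_self (inner ℝ u x)
        have h2 := abs_mul_abs_self (inner ℝ v x)
        simp only
        rw [← h1, ← h2, div_mul_eq_mul_div, div_mul_eq_mul_div, div_add_div _ _ (by positivity)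
          (by positivity), le_div_iff₀ (by positivity)]
        nlinarith
    _ = ‖u‖ * ‖v‖ := by
        rw [integral_add (hIu.const_mul _) (hIv.const_mul _), integral_const_mul,
          integral_const_mul, integral_inner_mul_inner, integral_inner_mul_inner,
          real_inner_self_eq_norm_sq, real_inner_self_eq_norm_sq]
        field_simp
        ring

/-! ### Small-ball estimates -/

/-- The density is at most `1 / √(2π) ≤ 1 / 2` on an interval of length `2c`. -/
theorem gaussianReal_real_abs_le {c : ℝ} (hc : 0 ≤ c) :
    (gaussianReal 0 1).real {t | |t| ≤ c} ≤ c := by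
  have hset : {t : ℝ | |t| ≤ c} = Set.Icc (-c) c := by ext t; simp [abs_le]
  have hpdf : ∀ t : ℝ, gaussianPDFReal 0 1 t ≤ 1 / 2 := by
    intro t
    rw [gaussianPDFReal]
    have h1 : (2 : ℝ) ≤ Real.sqrt (2 * Real.pi) := by
      rw [Real.le_sqrt (by norm_num) (by positivity)]
      nlinarith [Real.pi_gt_three]
    have h2 : Real.exp (-(t - 0) ^ 2 / (2 * ((1 : NNReal) : ℝ))) ≤ 1 := by
      rw [Real.exp_le_one_iff]
      simp only [NNReal.coe_one]
      nlinarith [sq_nonneg (t - 0)]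
    calc _ ≤ (Real.sqrt (2 * Real.pi))⁻¹ * 1 := by
          simp only [NNReal.coe_one, mul_one] at h2 ⊢
          exact mul_le_of_le_one_right (by positivity) h2
      _ ≤ 1 / 2 := by
          rw [mul_one, one_div]
          exact inv_anti₀ two_pos h1
  rw [hset, Measure.real, gaussianReal_apply_eq_integral 0 one_ne_zero]
  refine ENNReal.toReal_le_of_le_ofReal hc (ENNReal.ofReal_le_ofReal ?_)
  calc ∫ t in Set.Icc (-c) c, gaussianPDFReal 0 1 t
      ≤ ∫ t in Set.Icc (-c) c, (1 / 2 : ℝ) :=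
        setIntegral_mono_on (integrable_gaussianPDFReal 0 1).integrableOn
          (integrableOn_const (by simp)) measurableSet_Icc fun t _ => hpdf t
    _ = c := by
        rw [setIntegral_const, Measure.real, Real.volume_Icc,
          ENNReal.toReal_ofReal (by linarith), smul_eq_mul]
        ring

/-- A standard Gaussian variable independent of `Z` has absolute value at most `c(Z)` with
conditional probability at most `c(Z)`. -/
theorem integral_mul_indicator_abs_le {Ω F : Type*} [MeasurableSpace Ω] [MeasurableSpace F]
    {P : Measure Ω} [IsProbabilityMeasure P] {X : Ω → ℝ} {Z : Ω → F}
    (hX : HasLaw X (gaussianReal 0 1) P) (hZ : AEMeasurable Z P) (hXZ : IndepFun X Z P)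
    {f c : F → ℝ} (hf : Measurable f) (hc : Measurable c) (hf0 : ∀ z, 0 ≤ f z)
    (hc0 : ∀ z, 0 ≤ c z) (hfi : Integrable (fun ω => f (Z ω)) P)
    (hfci : Integrable (fun ω => f (Z ω) * c (Z ω)) P) :
    ∫ ω, f (Z ω) * (if |X ω| ≤ c (Z ω) then 1 else 0) ∂P ≤ ∫ ω, f (Z ω) * c (Z ω) ∂P := by
  have hmap := (indepFun_iff_map_prod_eq_prod_map_map hX.aemeasurable hZ).1 hXZ
  rw [hX.map_eq] at hmap
  have : IsProbabilityMeasure (P.map Z) := Measure.isProbabilityMeasure_map hZ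
  have hS : MeasurableSet {p : ℝ × F | |p.1| ≤ c p.2} :=
    measurableSet_le (by fun_prop) (by fun_prop)
  set H : ℝ × F → ℝ := fun p => f p.2 * (if |p.1| ≤ c p.2 then 1 else 0) with hH
  have hHm : Measurable H :=
    (hf.comp measurable_snd).mul (Measurable.ite hS measurable_const measurable_const)
  have hpair : AEMeasurable (fun ω => (X ω, Z ω)) P := hX.aemeasurable.prodMk hZ
  have hHint : Integrable (fun ω => H (X ω, Z ω)) P := by
    refine hfi.mono' (hHm.comp_aemeasurable hpair).aestronglyMeasurable
      (Filter.Eventually.of_forall fun ω => ?_)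
    simp only [hH]
    split_ifs <;> simp [abs_of_nonneg (hf0 _), hf0]
  have hHprod : Integrable H ((gaussianReal 0 1).prod (P.map Z)) := by
    rw [← hmap]
    exact (integrable_map_measure hHm.aestronglyMeasurable hpair).2 hHint
  have hfcmap : Integrable (fun z => f z * c z) (P.map Z) :=
    (integrable_map_measure (hf.mul hc).aestronglyMeasurable hZ).2 hfci
  calc ∫ ω, H (X ω, Z ω) ∂P = ∫ p, H p ∂(P.map fun ω => (X ω, Z ω)) :=
        (integral_map hpair hHm.aestronglyMeasurable).symm
    _ = ∫ z, ∫ t, H (t, z) ∂(gaussianReal 0 1) ∂(P.map Z) := by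
        rw [hmap, integral_prod_symm _ hHprod]
    _ ≤ ∫ z, f z * c z ∂(P.map Z) := by
        refine integral_mono hHprod.integral_prod_right hfcmap fun z => ?_
        have hSz : MeasurableSet {t : ℝ | |t| ≤ c z} :=
          measurableSet_le (by fun_prop) measurable_const
        have : ∫ t, H (t, z) ∂(gaussianReal 0 1) = f z * (gaussianReal 0 1).real {t | |t| ≤ c z} := by
          simp only [hH]
          rw [integral_const_mul, ← integral_indicator_one hSz]
          rfl
        simp only [this]
        exact mul_le_mul_of_nonneg_left (gaussianReal_real_abs_le (hc0 z)) (hf0 z)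
    _ = ∫ ω, f (Z ω) * c (Z ω) ∂P := integral_map hZ (hf.mul hc).aestronglyMeasurable

/-- The component of a standard Gaussian vector along a direction is independent of the orthogonal
component. -/
theorem indepFun_inner_sub_smul {n : E} (hn : ‖n‖ = 1) :
    IndepFun (fun x : E => inner ℝ n x) (fun x => x - inner ℝ n x • n) (stdGaussian E) := by
  set L : E →L[ℝ] ℝ × E := (innerSL ℝ n).prod
    (ContinuousLinearMap.id ℝ E - (innerSL ℝ n).smulRight n)
  have hL : HasGaussianLaw (fun x : E => (inner ℝ n x, x - inner ℝ n x • n)) (stdGaussian E) :=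
    (IsGaussian.hasGaussianLaw_id (μ := stdGaussian E)).map_fun L
  -- The pair is jointly Gaussian, so vanishing covariances suffice.
  refine hL.indepFun_of_covariance_inner fun c y => ?_
  have h1 : (fun x : E => inner ℝ c (inner ℝ n x : ℝ)) = fun x => inner ℝ (c • n) x := by
    ext x; simp [real_inner_smul_left, mul_comm]
  have h2 : (fun x : E => inner ℝ y (x - inner ℝ n x • n)) =
      fun x => inner ℝ (y - inner ℝ n y • n) x := by
    ext x; exact inner_sub_inner_smul n y x
  rw [h1, h2, covariance_eq_sub (memLp_inner_stdGaussian _ 2 (by simp))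
    (memLp_inner_stdGaussian _ 2 (by simp)), integral_inner_stdGaussian, zero_mul, sub_zero]
  refine (integral_inner_mul_inner _ _).trans ?_
  rw [real_inner_smul_left, inner_sub_right, real_inner_smul_right, real_inner_self_eq_norm_sq, hn]
  ring

end Gaussian
-- Orthogonal splitting and linearization of the gated increment.
theorem inner_eq_mul_add_inner_sub {V : Type*} [NormedAddCommGroup V] [InnerProductSpace ℝ V]
    (n u x : V) :
    inner ℝ u x = inner ℝ n u * inner ℝ n x + inner ℝ (u - inner ℝ n u • n) x := by
  rw [inner_sub_left, real_inner_smul_left]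
  ring

theorem norm_sub_inner_smul_le {V : Type*} [NormedAddCommGroup V] [InnerProductSpace ℝ V] {n : V} (hn : ‖n‖ = 1)
    (v : V) :
    ‖v - inner ℝ n v • n‖ ≤ ‖v‖ := by
  refine (sq_le_sq₀ (norm_nonneg _) (norm_nonneg _)).1 ?_
  rw [norm_sub_sq_real, real_inner_smul_right, real_inner_comm, norm_smul, hn, mul_one,
    Real.norm_eq_abs, sq_abs]
  nlinarith [sq_nonneg (inner ℝ n v)]

/-- The increment of a neuron when its weight `a` is shifted by `b`, gated by the activity of
the unshifted neuron. -/
def gatedShift {V : Type*} [NormedAddCommGroup V] [InnerProductSpace ℝ V] (a b x : V) : ℝ :=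
  (relu (inner ℝ (a + b) x) - relu (inner ℝ a x)) * reluDeriv (inner ℝ a x)

theorem abs_gatedShift_le {V : Type*} [NormedAddCommGroup V] [InnerProductSpace ℝ V]
    (a b x : V) : |gatedShift a b x| ≤ |inner ℝ b x| := by
  have h1 : |relu (inner ℝ (a + b) x) - relu (inner ℝ a x)| ≤ |inner ℝ b x| := by
    refine (abs_max_sub_max_le_max _ _ _ _).trans ?_
    rw [inner_add_left]
    simp
  rw [gatedShift, abs_mul, reluDeriv]
  split_ifs <;> simp [h1]

/-- The linearization is exact unless the neuron is active before the shift and inactive after it.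
Then the error is exactly `|⟪a + b, x⟫|`, and the sign change forces it below `|⟪b, x⟫|`. -/
theorem abs_gatedShift_sub_le {V : Type*} [NormedAddCommGroup V] [InnerProductSpace ℝ V]
    (a b x : V) :
    |gatedShift a b x - inner ℝ b x * reluDeriv (inner ℝ a x)| ≤ |inner ℝ (a + b) x| *
      (if |inner ℝ (a + b) x| ≤ |inner ℝ b x| then (1 : ℝ) else 0) := by
  have h : inner ℝ (a + b) x = inner ℝ a x + inner ℝ b x := inner_add_left _ _ _
  rw [gatedShift, h]
  set α := (inner ℝ a x : ℝ)
  set β := (inner ℝ b x : ℝ)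
  rw [reluDeriv]
  by_cases hα : 0 < α
  · rw [if_pos hα, mul_one, mul_one, relu, relu, max_eq_right hα.le]
    rcases le_total 0 (α + β) with h0 | h0
    · rw [max_eq_right h0]
      have : α + β - α - β = 0 := by ring
      rw [this, abs_zero]
      split_ifs <;> simp
    · have hle : |α + β| ≤ |β| := by
        rw [abs_of_nonpos h0, abs_of_nonpos (by linarith)]; linarith
      rw [max_eq_left h0, if_pos hle, mul_one, ← abs_neg (α + β)]
      exact le_of_eq (congrArg _ (by ring))
  · rw [if_neg hα, mul_zero, mul_zero, sub_zero, abs_zero]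
    split_ifs <;> simp

section Gaussian
variable {E : Type*} [NormedAddCommGroup E] [InnerProductSpace ℝ E] [FiniteDimensional ℝ E]
  [MeasurableSpace E] [BorelSpace E]

theorem measurable_ite_abs_inner_le (w b : E) :
    Measurable fun x : E => if |inner ℝ w x| ≤ |inner ℝ b x| then (1 : ℝ) else 0 :=
  Measurable.ite (measurableSet_le (by fun_prop) (by fun_prop)) measurable_const measurable_const

theorem integrable_abs_inner_mul_ite (v w b : E) :
    Integrable (fun x => |inner ℝ v x| * |inner ℝ w x| *
      (if |inner ℝ w x| ≤ |inner ℝ b x| then (1 : ℝ) else 0)) (stdGaussian E) := by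
  refine (integrable_abs_inner_mul_abs_inner v w).mono'
    ((by fun_prop : Measurable fun x : E => |inner ℝ v x| * |inner ℝ w x|).mul
      (measurable_ite_abs_inner_le w b)).aestronglyMeasurable
    (Filter.Eventually.of_forall fun x => ?_)
  split_ifs <;> simp [mul_nonneg]

/-- The contribution of the region where `⟪w, x⟫` is dominated by `⟪b, x⟫` is of second order
in `‖b‖ / ‖w‖`. -/
theorem integral_abs_inner_mul_ite_le (v : E) {w : E} (hw : w ≠ 0) (b : E) :
    ∫ x, |inner ℝ v x| * |inner ℝ w x| *
      (if |inner ℝ w x| ≤ |inner ℝ b x| then (1 : ℝ) else 0) ∂(stdGaussian E) ≤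
    102 * (‖v‖ * ‖b‖ ^ 2 / ‖w‖) := by
  have hs : 0 < ‖w‖ := norm_pos_iff.2 hw
  set s := ‖w‖ with hsdef
  set n := s⁻¹ • w with hndef
  have hn : ‖n‖ = 1 := norm_smul_inv_norm hw
  have hwn : ∀ x : E, inner ℝ w x = s * inner ℝ n x := by
    intro x
    rw [hndef, real_inner_smul_left, mul_inv_cancel_left₀ hs.ne']
  -- If `b` has a large component along `w`, then `‖b‖ ≥ s / 2` and Cauchy–Schwarz is enough.
  -- Otherwise that component can be absorbed, and the slab condition becomes `|⟪n, x⟫| ≤ (2 / s)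
  -- |⟪b', x⟫|`, whose right side is independent of `⟪n, x⟫`.
  rcases lt_or_ge (s / 2) |inner ℝ n b| with hbig | hsmall
  · have hb : s / 2 ≤ ‖b‖ := by
      refine hbig.le.trans ((abs_real_inner_le_norm n b).trans ?_)
      rw [hn, one_mul]
    calc _ ≤ ∫ x, |inner ℝ v x| * |inner ℝ b x| ∂(stdGaussian E) := by
          refine integral_mono (integrable_abs_inner_mul_ite v w b)
            (integrable_abs_inner_mul_abs_inner v b) fun x => ?_
          simp only
          split_ifs with h
          · rw [mul_one]; gcongr
          · rw [mul_zero]; positivity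
      _ ≤ ‖v‖ * ‖b‖ := integral_abs_inner_mul_abs_inner_le v b
      _ ≤ 102 * (‖v‖ * ‖b‖ ^ 2 / s) := by
          rw [← mul_div_assoc, le_div_iff₀ hs]
          nlinarith [mul_nonneg (norm_nonneg v) (norm_nonneg b),
            mul_le_mul_of_nonneg_left hb (mul_nonneg (norm_nonneg v) (norm_nonneg b))]
  · set b' := b - inner ℝ n b • n with hb'
    set v' := v - inner ℝ n v • n with hv'
    have hproj : ∀ u x : E, inner ℝ u (x - inner ℝ n x • n) =
        inner ℝ (u - inner ℝ n u • n) x := inner_sub_inner_smul n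
    set f : E → ℝ := fun z => |inner ℝ v z| * |inner ℝ b z| with hf
    set c : E → ℝ := fun z => 2 / s * |inner ℝ b z| with hc
    have hfZ : ∀ x, f (x - inner ℝ n x • n) = |inner ℝ v' x| * |inner ℝ b' x| := by
      intro x; simp only [hf, hproj, hb', hv']
    have hcZ : ∀ x, c (x - inner ℝ n x • n) = 2 / s * |inner ℝ b' x| := by
      intro x; simp only [hc, hproj, hb']
    have hfc : ∀ x, f (x - inner ℝ n x • n) * c (x - inner ℝ n x • n) =
        2 / s * (|inner ℝ v' x| * (inner ℝ b' x) ^ 2) := by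
      intro x
      rw [hfZ, hcZ, ← sq_abs (inner ℝ b' x)]
      ring
    have hfi : Integrable (fun x => f (x - inner ℝ n x • n)) (stdGaussian E) := by
      simp only [hfZ]
      exact integrable_abs_inner_mul_abs_inner v' b'
    have hball := integral_mul_indicator_abs_le (P := stdGaussian E)
      (hasLaw_inner_stdGaussian hn) (Z := fun x => x - inner ℝ n x • n) (by fun_prop)
      (indepFun_inner_sub_smul hn) (f := f) (c := c) (by fun_prop) (by fun_prop)
      (fun z => by positivity) (fun z => by positivity) hfi
      (by simp only [hfc]; exact (integrable_abs_inner_mul_sq v' b').const_mul _)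
    simp only [hfc, integral_const_mul] at hball
    simp only [hfZ, hcZ] at hball
    have hmeas : Measurable fun x : E =>
        if |inner ℝ n x| ≤ 2 / s * |inner ℝ b' x| then (1 : ℝ) else 0 :=
      Measurable.ite (measurableSet_le (by fun_prop) (by fun_prop)) measurable_const
        measurable_const
    have hint2 : Integrable (fun x => |inner ℝ v' x| * |inner ℝ b' x| *
        (if |inner ℝ n x| ≤ 2 / s * |inner ℝ b' x| then (1 : ℝ) else 0)) (stdGaussian E) := by
      refine (integrable_abs_inner_mul_abs_inner v' b').mono'
        ((by fun_prop : Measurable fun x : E => |inner ℝ v' x| * |inner ℝ b' x|).mul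
          hmeas).aestronglyMeasurable (Filter.Eventually.of_forall fun x => ?_)
      split_ifs <;> simp [mul_nonneg]
    have hint1 := integrable_inner_mul_inner b' b'
    -- On the slab, `s |⟪n, x⟫| ≤ 2 |⟪b', x⟫|`. The part of `v` along `n` then contributes the term
    -- with `4 / s`, and `v'` contributes the term with 2; integrating gives `4 + 2 * 2 * (49 / 2) =
    -- 102`.
    have hpt : ∀ x : E, |inner ℝ v x| * |inner ℝ w x| *
        (if |inner ℝ w x| ≤ |inner ℝ b x| then (1 : ℝ) else 0) ≤
        (4 / s * ‖v‖) * (inner ℝ b' x * inner ℝ b' x) + 2 * (|inner ℝ v' x| * |inner ℝ b' x| *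
        (if |inner ℝ n x| ≤ 2 / s * |inner ℝ b' x| then (1 : ℝ) else 0)) := by
      intro x
      have hrhs : 0 ≤ (4 / s * ‖v‖) * (inner ℝ b' x * inner ℝ b' x) +
          2 * (|inner ℝ v' x| * |inner ℝ b' x| *
          (if |inner ℝ n x| ≤ 2 / s * |inner ℝ b' x| then (1 : ℝ) else 0)) := by
        have : 0 ≤ inner ℝ b' x * inner ℝ b' x := mul_self_nonneg _
        split_ifs <;> positivity
      split_ifs at hrhs ⊢ with h1 h2 h2
      · have hvx : |inner ℝ v x| ≤ ‖v‖ * |inner ℝ n x| + |inner ℝ v' x| := by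
          have e : inner ℝ v x = inner ℝ n v * inner ℝ n x + inner ℝ v' x := inner_eq_mul_add_inner_sub n v x
          rw [e]
          refine (abs_add_le _ _).trans (add_le_add_left ?_ _)
          rw [abs_mul]
          refine mul_le_mul_of_nonneg_right ((abs_real_inner_le_norm n v).trans ?_) (abs_nonneg _)
          rw [hn, one_mul]
        set t := |inner ℝ n x|
        set z := |inner ℝ b' x|
        set y := |inner ℝ v' x|
        have ht0 : 0 ≤ t := abs_nonneg _
        have hz0 : 0 ≤ z := abs_nonneg _
        have hy0 : 0 ≤ y := abs_nonneg _
        have hst : s * t ≤ 2 * z := by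
          rw [div_mul_eq_mul_div, le_div_iff₀ hs] at h2; linarith
        rw [hwn, abs_mul, abs_of_pos hs, ← abs_mul_abs_self (inner ℝ b' x)]
        have hz4 : ‖v‖ * t * (s * t) ≤ 4 / s * ‖v‖ * (z * z) := by
          rw [div_mul_eq_mul_div, div_mul_eq_mul_div, le_div_iff₀ hs]
          have : (s * t) * (s * t) ≤ (2 * z) * (2 * z) := mul_self_le_mul_self (by positivity) hst
          nlinarith [norm_nonneg v, mul_le_mul_of_nonneg_left this (norm_nonneg v)]
        have hst' : y * (s * t) ≤ y * (2 * z) := mul_le_mul_of_nonneg_left hst hy0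
        have := mul_le_mul_of_nonneg_right hvx (mul_nonneg hs.le ht0)
        linarith
      · exfalso
        apply h2
        have e : inner ℝ b x = inner ℝ n b * inner ℝ n x + inner ℝ b' x := inner_eq_mul_add_inner_sub n b x
        rw [hwn, abs_mul, abs_of_pos hs, e] at h1
        have h3 := h1.trans (abs_add_le _ _)
        rw [abs_mul] at h3
        have h4 := mul_le_mul_of_nonneg_right hsmall (abs_nonneg (inner ℝ n x))
        rw [div_mul_eq_mul_div, le_div_iff₀ hs]
        linarith
      · simpa using hrhs
      · simpa using hrhs
    have hb'le : ‖b'‖ ^ 2 ≤ ‖b‖ ^ 2 :=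
      pow_le_pow_left₀ (norm_nonneg _) (norm_sub_inner_smul_le hn b) 2
    have hv'le : ‖v'‖ ≤ ‖v‖ := norm_sub_inner_smul_le hn v
    calc _ ≤ ∫ x, ((4 / s * ‖v‖) * (inner ℝ b' x * inner ℝ b' x) +
          2 * (|inner ℝ v' x| * |inner ℝ b' x| *
          (if |inner ℝ n x| ≤ 2 / s * |inner ℝ b' x| then (1 : ℝ) else 0))) ∂(stdGaussian E) :=
          integral_mono (integrable_abs_inner_mul_ite v w b)
            ((hint1.const_mul _).add (hint2.const_mul _)) hpt
      _ = (4 / s * ‖v‖) * ‖b'‖ ^ 2 + 2 * ∫ x, (|inner ℝ v' x| * |inner ℝ b' x| *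
          (if |inner ℝ n x| ≤ 2 / s * |inner ℝ b' x| then (1 : ℝ) else 0)) ∂(stdGaussian E) := by
          rw [integral_add (hint1.const_mul _) (hint2.const_mul _), integral_const_mul,
            integral_const_mul, integral_inner_mul_inner, real_inner_self_eq_norm_sq]
      _ ≤ (4 / s * ‖v‖) * ‖b'‖ ^ 2 + 2 * (2 / s * (49 / 2 * (‖v'‖ * ‖b'‖ ^ 2))) := by
          gcongr
          exact hball.trans (mul_le_mul_of_nonneg_left (integral_abs_inner_mul_sq_le v' b')
            (by positivity))
      _ ≤ (4 / s * ‖v‖) * ‖b‖ ^ 2 + 2 * (2 / s * (49 / 2 * (‖v‖ * ‖b‖ ^ 2))) := by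
          gcongr
      _ = 102 * (‖v‖ * ‖b‖ ^ 2 / s) := by ring

/-! ### The expected one-step gradient -/

theorem measurable_relu : Measurable relu := measurable_const.max measurable_id

theorem measurable_reluDeriv : Measurable reluDeriv :=
  Measurable.ite (measurableSet_lt measurable_const measurable_id) measurable_const
    measurable_const

theorem measurable_gatedShift (a b : E) : Measurable (gatedShift a b) :=
  ((measurable_relu.comp (by fun_prop)).sub (measurable_relu.comp (by fun_prop))).mul
    (measurable_reluDeriv.comp (by fun_prop))

theorem integrable_inner_mul_gatedShift (v a b : E) :
    Integrable (fun x => inner ℝ v x * gatedShift a b x) (stdGaussian E) := by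
  refine (integrable_abs_inner_mul_abs_inner v b).mono'
    ((by fun_prop : Measurable fun x : E => (inner ℝ v x : ℝ)).mul
      (measurable_gatedShift a b)).aestronglyMeasurable (Filter.Eventually.of_forall fun x => ?_)
  rw [Real.norm_eq_abs, abs_mul]
  exact mul_le_mul_of_nonneg_left (abs_gatedShift_le a b x) (abs_nonneg _)

theorem integrable_mul_reluDeriv_inner (u v a : E) :
    Integrable (fun x => inner ℝ u x * inner ℝ v x * reluDeriv (inner ℝ a x)) (stdGaussian E) := by
  refine (integrable_abs_inner_mul_abs_inner u v).mono'
    ((by fun_prop : Measurable fun x : E => (inner ℝ u x * inner ℝ v x : ℝ)).mul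
      (measurable_reluDeriv.comp (by fun_prop))).aestronglyMeasurable
    (Filter.Eventually.of_forall fun x => ?_)
  rw [Real.norm_eq_abs, abs_mul, abs_mul, reluDeriv]
  split_ifs <;> simp [mul_nonneg]

/-- Half-space second moments of the standard Gaussian measure. -/
theorem integral_inner_mul_inner_mul_reluDeriv (u v : E) {a : E} (ha : a ≠ 0) :
    ∫ x, inner ℝ u x * inner ℝ v x * reluDeriv (inner ℝ a x) ∂(stdGaussian E) =
      inner ℝ u v / 2 := by
  set h : E → ℝ := fun x => inner ℝ u x * inner ℝ v x * reluDeriv (inner ℝ a x) with hh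
  have hi : Integrable h (stdGaussian E) := integrable_mul_reluDeriv_inner u v a
  -- Reflection carries the integral to the opposite half-space. The two halves sum to the full
  -- second moment, since the separating hyperplane is null.
  have hmp : MeasurePreserving (LinearIsometryEquiv.neg ℝ : E ≃ₗᵢ[ℝ] E) (stdGaussian E)
      (stdGaussian E) :=
    ⟨(LinearIsometryEquiv.neg ℝ : E ≃ₗᵢ[ℝ] E).continuous.measurable, stdGaussian_map _⟩
  have hneg : ∫ x, h (-x) ∂(stdGaussian E) = ∫ x, h x ∂(stdGaussian E) :=
    hmp.integral_comp' (f := (LinearIsometryEquiv.neg ℝ : E ≃ₗᵢ[ℝ] E).toMeasurableEquiv) h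
  have hineg : Integrable (fun x => h (-x)) (stdGaussian E) :=
    (hmp.integrable_comp hi.aestronglyMeasurable).2 hi
  have hne : ∀ᵐ x ∂(stdGaussian E), inner ℝ a x ≠ 0 := by
    have hlaw := hasLaw_inner_stdGaussian (norm_smul_inv_norm ha : ‖(‖a‖⁻¹ : ℝ) • a‖ = 1)
    have := nullSingletonClass_gaussianReal (μ := 0) (v := 1) one_ne_zero
    have h0 : ∀ᵐ t ∂(gaussianReal 0 1), t ≠ 0 := by
      rw [ae_iff]; simp
    rw [← hlaw.map_eq] at h0
    filter_upwards [ae_of_ae_map hlaw.aemeasurable h0] with x hx hax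
    apply hx
    rw [real_inner_smul_left, hax, mul_zero]
  have hsum : ∫ x, (h x + h (-x)) ∂(stdGaussian E) = inner ℝ u v := by
    rw [← integral_inner_mul_inner u v]
    refine integral_congr_ae (hne.mono fun x hx => ?_)
    simp only [hh, inner_neg_right, reluDeriv]
    rcases lt_or_gt_of_ne hx with h1 | h1
    · rw [if_neg h1.not_gt, if_pos (by linarith)]; ring
    · rw [if_pos h1, if_neg (by linarith)]; ring
  rw [integral_add hi hineg, hneg] at hsum
  linarith

/-- The test direction `v` is left arbitrary so that it can later be the error column itself. -/
theorem abs_integral_inner_mul_gatedShift_sub_le (v a : E) {b : E} (hab : a + b ≠ 0) :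
    |∫ x, inner ℝ v x * gatedShift a b x ∂(stdGaussian E) - inner ℝ v b / 2| ≤
      102 * (‖v‖ * ‖b‖ ^ 2 / ‖a + b‖) := by
  -- At `a = 0` the convention `reluDeriv 0 = 0` shuts the gate everywhere. The whole of `⟪v, b⟫ /
  -- 2` is then error, which is allowed because `‖a + b‖ = ‖b‖`.
  rcases eq_or_ne a 0 with rfl | ha
  · rw [zero_add] at hab ⊢
    have hb : 0 < ‖b‖ := norm_pos_iff.2 hab
    have : ∀ x : E, gatedShift 0 b x = 0 := fun x => by simp [gatedShift, reluDeriv]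
    simp only [this, mul_zero, integral_zero, zero_sub, abs_neg]
    rw [abs_div, abs_two]
    have h1 := abs_real_inner_le_norm v b
    have h2 : ‖v‖ * ‖b‖ ^ 2 / ‖b‖ = ‖v‖ * ‖b‖ := by field_simp
    rw [h2]
    have : 0 ≤ ‖v‖ * ‖b‖ := by positivity
    linarith
  rw [← integral_inner_mul_inner_mul_reluDeriv v b ha,
    ← integral_sub (integrable_inner_mul_gatedShift v a b) (integrable_mul_reluDeriv_inner v b a)]
  refine (abs_integral_le_integral_abs).trans (le_trans ?_
    (integral_abs_inner_mul_ite_le v hab b))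
  refine integral_mono ((integrable_inner_mul_gatedShift v a b).sub
    (integrable_mul_reluDeriv_inner v b a)).abs (integrable_abs_inner_mul_ite v (a + b) b)
    fun x => ?_
  simp only
  rw [mul_assoc (inner ℝ v x), ← mul_sub, abs_mul, mul_assoc]
  exact mul_le_mul_of_nonneg_left (abs_gatedShift_sub_le a b x) (abs_nonneg _)

end Gaussian

/-! ### Concentration of averages of sub-exponential variables -/

theorem integrable_of_integrable_exp_abs {F : Type*} [MeasurableSpace F] {ν : Measure F}
    {φ : F → ℝ} (hφ : Measurable φ) (hi : Integrable (fun x => Real.exp (|φ x| / 4)) ν) :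
    Integrable φ ν := by
  refine (hi.const_mul 4).mono' hφ.aestronglyMeasurable (Filter.Eventually.of_forall fun x => ?_)
  rw [Real.norm_eq_abs]
  linarith [Real.add_one_le_exp (|φ x| / 4)]

/-- Integrate `|t| ≤ 4 (exp (|t| / 4) - 1)`. -/
theorem abs_integral_le_of_integral_exp_abs_le {F : Type*} [MeasurableSpace F] {ν : Measure F}
    [IsProbabilityMeasure ν] {φ : F → ℝ} (hφ : Measurable φ)
    (hi : Integrable (fun x => Real.exp (|φ x| / 4)) ν)
    (hle : ∫ x, Real.exp (|φ x| / 4) ∂ν ≤ 3 / 2) : |∫ x, φ x ∂ν| ≤ 2 := by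
  have h1 : ∫ x, |φ x| ∂ν ≤ ∫ x, (4 * Real.exp (|φ x| / 4) - 4) ∂ν :=
    integral_mono (integrable_of_integrable_exp_abs hφ hi).abs
      ((hi.const_mul 4).sub (integrable_const _)) fun x => by
        linarith [Real.add_one_le_exp (|φ x| / 4)]
  rw [integral_sub (hi.const_mul 4) (integrable_const _), integral_const_mul] at h1
  simp only [integral_const, probReal_univ, one_smul] at h1
  exact abs_integral_le_integral_abs.trans (by linarith)

/-- The Taylor remainder is at most `(l v)² exp |l v|`. Half of the exponent `|v| / 4` absorbs `exp
|l v|`, the other half absorbs `v²` at the cost of 128. -/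
theorem exp_mul_le_of_abs_le {l v : ℝ} (hl : |l| ≤ 1 / 8) :
    Real.exp (l * v) ≤ 1 + l * v + 128 * l ^ 2 * Real.exp (|v| / 4) := by
  have h1 := Complex.norm_exp_sub_sum_le_norm_mul_exp ((l * v : ℝ) : ℂ) 2
  have e : Complex.exp ((l * v : ℝ) : ℂ) -
      ∑ m ∈ Finset.range 2, ((l * v : ℝ) : ℂ) ^ m / (m.factorial : ℂ) =
      ((Real.exp (l * v) - (1 + l * v) : ℝ) : ℂ) := by
    simp [Finset.sum_range_succ]
  rw [e, Complex.norm_real, Complex.norm_real, Real.norm_eq_abs, Real.norm_eq_abs] at h1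
  have h2 := (le_abs_self _).trans h1
  have h3 : |l * v| ≤ |v| / 8 := by
    rw [abs_mul]
    linarith [mul_le_mul_of_nonneg_right hl (abs_nonneg v)]
  have h4 : v ^ 2 ≤ 128 * Real.exp (|v| / 8) := by
    have := Real.quadratic_le_exp_of_nonneg (x := |v| / 8) (by positivity)
    have h5 := sq_abs v
    nlinarith [abs_nonneg v]
  have h5 : |l * v| ^ 2 * Real.exp |l * v| ≤ l ^ 2 * (128 * Real.exp (|v| / 8)) *
      Real.exp (|v| / 8) := by
    rw [sq_abs, mul_pow]
    gcongr
  have h6 : Real.exp (|v| / 8) * Real.exp (|v| / 8) = Real.exp (|v| / 4) := by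
    rw [← Real.exp_add]; congr 1; ring
  have h7 : l ^ 2 * (128 * Real.exp (|v| / 8)) * Real.exp (|v| / 8) =
      128 * l ^ 2 * Real.exp (|v| / 4) := by rw [← h6]; ring
  linarith

theorem exp_abs_sub_le (y m : ℝ) :
    Real.exp (|y - m| / 4) ≤ Real.exp (|m| / 4) * Real.exp (|y| / 4) := by
  rw [← Real.exp_add, Real.exp_le_exp]
  linarith [abs_sub y m]

theorem integrable_exp_mul_sub_integral {F : Type*} [MeasurableSpace F] {ν : Measure F}
    [IsProbabilityMeasure ν] {φ : F → ℝ} (hφ : Measurable φ)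
    (hi : Integrable (fun x => Real.exp (|φ x| / 4)) ν) (m : ℝ) {l : ℝ} (hl : |l| ≤ 1 / 8) :
    Integrable (fun x => Real.exp (l * (φ x - m))) ν := by
  refine (hi.const_mul (Real.exp (|m| / 4))).mono' (by fun_prop)
    (Filter.Eventually.of_forall fun x => ?_)
  rw [Real.norm_eq_abs, Real.abs_exp]
  refine le_trans ?_ (exp_abs_sub_le _ _)
  rw [Real.exp_le_exp]
  refine (le_abs_self _).trans ?_
  rw [abs_mul]
  nlinarith [mul_le_mul_of_nonneg_right hl (abs_nonneg (φ x - m)), abs_nonneg (φ x - m)]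

/-- A centred sub-exponential variable has a sub-Gaussian moment generating function near `0`. -/
theorem mgf_sub_integral_le {F : Type*} [MeasurableSpace F] {ν : Measure F}
    [IsProbabilityMeasure ν] {φ : F → ℝ} (hφ : Measurable φ)
    (hi : Integrable (fun x => Real.exp (|φ x| / 4)) ν)
    (hle : ∫ x, Real.exp (|φ x| / 4) ∂ν ≤ 3 / 2) {l : ℝ} (hl : |l| ≤ 1 / 8) :
    mgf (fun x => φ x - ∫ y, φ y ∂ν) ν l ≤ Real.exp (320 * l ^ 2) := by
  have hφi := integrable_of_integrable_exp_abs hφ hi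
  have hm := abs_integral_le_of_integral_exp_abs_le hφ hi hle
  set m := ∫ y, φ y ∂ν with hmdef
  have hvi : Integrable (fun x => φ x - m) ν := hφi.sub (integrable_const _)
  have hv0 : ∫ x, (φ x - m) ∂ν = 0 := by
    rw [integral_sub hφi (integrable_const _), ← hmdef]; simp
  have hexpi : Integrable (fun x => Real.exp (|φ x - m| / 4)) ν := by
    refine (hi.const_mul (Real.exp (|m| / 4))).mono' (by fun_prop)
      (Filter.Eventually.of_forall fun x => ?_)
    rw [Real.norm_eq_abs, Real.abs_exp]
    exact exp_abs_sub_le _ _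
  -- Since `|m| ≤ 2`, centring costs at most `exp (1 / 2) ≤ 5 / 3`; then `128 * (5 / 3) * (3 / 2) =
  -- 320`.
  have hhalf : Real.exp (|m| / 4) ≤ 5 / 3 := by
    have h1 : Real.exp (|m| / 4) ≤ Real.exp (1 / 2) := Real.exp_le_exp.2 (by linarith)
    have h2 : Real.exp (1 / 2) * Real.exp (1 / 2) = Real.exp 1 := by
      rw [← Real.exp_add]; norm_num
    have h3 := Real.exp_one_lt_d9
    nlinarith [Real.exp_pos (1 / 2)]
  have hexp : ∫ x, Real.exp (|φ x - m| / 4) ∂ν ≤ 5 / 2 := by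
    calc _ ≤ ∫ x, Real.exp (|m| / 4) * Real.exp (|φ x| / 4) ∂ν :=
          integral_mono hexpi (hi.const_mul _) fun x => exp_abs_sub_le _ _
      _ ≤ 5 / 3 * (3 / 2) := by
          rw [integral_const_mul]
          exact mul_le_mul hhalf hle (integral_nonneg fun _ => (Real.exp_pos _).le) (by norm_num)
      _ = 5 / 2 := by norm_num
  have hlin : Integrable (fun x => 1 + l * (φ x - m)) ν :=
    (integrable_const _).add (hvi.const_mul _)
  calc mgf (fun x => φ x - m) ν l
      ≤ ∫ x, ((1 + l * (φ x - m)) + 128 * l ^ 2 * Real.exp (|φ x - m| / 4)) ∂ν :=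
        integral_mono (integrable_exp_mul_sub_integral hφ hi m hl)
          (hlin.add (hexpi.const_mul _))
          fun x => exp_mul_le_of_abs_le hl
    _ = 1 + 128 * l ^ 2 * ∫ x, Real.exp (|φ x - m| / 4) ∂ν := by
        rw [integral_add hlin (hexpi.const_mul _),
          integral_add (integrable_const _) (hvi.const_mul _), integral_const_mul,
          integral_const_mul, hv0]
        simp
    _ ≤ 320 * l ^ 2 + 1 := by nlinarith [sq_nonneg l]
    _ ≤ Real.exp (320 * l ^ 2) := Real.add_one_le_exp _

/-- A Bernstein-type bound for averages of i.i.d. sub-exponential variables. -/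
theorem measureReal_abs_average_sub_gt_le {Ω F : Type*} [MeasurableSpace Ω] [MeasurableSpace F]
    {μ : Measure Ω} [IsProbabilityMeasure μ] {ν : Measure F} [IsProbabilityMeasure ν] {N : ℕ}
    (hN : 0 < N) {x : Fin N → Ω → F} (hlaw : ∀ i, HasLaw (x i) ν μ) (hind : iIndepFun x μ)
    {φ : F → ℝ} (hφ : Measurable φ) (hi : Integrable (fun y => Real.exp (|φ y| / 4)) ν)
    (hle : ∫ y, Real.exp (|φ y| / 4) ∂ν ≤ 3 / 2) {ε : ℝ} (hε0 : 0 < ε) (hε1 : ε < 1) :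
    μ.real {ω | 48 * ε < |1 / (N : ℝ) * ∑ i, φ (x i ω) - ∫ y, φ y ∂ν|} ≤
      2 * Real.exp (-((N : ℝ) * ε ^ 2)) := by
  set m := ∫ y, φ y ∂ν with hm
  set ψ : F → ℝ := fun y => φ y - m with hψ
  have hψm : Measurable ψ := hφ.sub_const m
  set V : Fin N → Ω → ℝ := fun i => ψ ∘ x i with hV
  have hVm : ∀ i, AEMeasurable (V i) μ := fun i =>
    hψm.comp_aemeasurable (hlaw i).aemeasurable
  have hVind : iIndepFun V μ := hind.comp (fun _ => ψ) fun _ => hψm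
  have hN' : (0 : ℝ) < N := Nat.cast_pos.2 hN
  have hVint : ∀ {l : ℝ}, |l| ≤ 1 / 8 → ∀ i, Integrable (fun ω => Real.exp (l * V i ω)) μ := by
    intro l hl i
    have h := integrable_exp_mul_sub_integral hφ hi m hl
    rw [← (hlaw i).map_eq] at h
    exact h.comp_aemeasurable (hlaw i).aemeasurable
  have hVmgf : ∀ {l : ℝ}, |l| ≤ 1 / 8 → ∀ i, mgf (V i) μ l ≤ Real.exp (320 * l ^ 2) := by
    intro l hl i
    have h := mgf_sub_integral_le hφ hi hle hl
    have e : mgf (V i) μ l = mgf ψ ν l := by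
      rw [← (hlaw i).map_eq, mgf_map (hlaw i).aemeasurable (by fun_prop)]
    rw [e]
    exact h
  have hsum : ∀ {l : ℝ}, |l| ≤ 1 / 8 →
      mgf (∑ i, V i) μ l ≤ Real.exp (N * (320 * l ^ 2)) := by
    intro l hl
    rw [hVind.mgf_sum₀ hVm]
    calc ∏ i, mgf (V i) μ l ≤ ∏ _i : Fin N, Real.exp (320 * l ^ 2) :=
          Finset.prod_le_prod (fun _ _ => mgf_nonneg) fun i _ => hVmgf hl i
      _ = _ := by rw [Finset.prod_const, Finset.card_univ, Fintype.card_fin, ← Real.exp_nat_mul]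
  -- If the exponential were not integrable, the moment generating function would take the default
  -- value 0, whereas it is a product of positive factors.
  have hsumint : ∀ {l : ℝ}, |l| ≤ 1 / 8 →
      Integrable (fun ω => Real.exp (l * (∑ i, V i) ω)) μ := fun {l} hl =>
    by_contra fun h => by
      have h0 := mgf_undef h
      rw [hVind.mgf_sum₀ hVm] at h0
      exact (Finset.prod_pos fun i _ => mgf_pos (hVint hl i)).ne' h0
  -- With the Chernoff parameter `ε / 8` the exponent is `-6 N ε² + 5 N ε² = -N ε²`; `ε < 1` keeps
  -- the parameter in the admissible range.
  have hl1 : |ε / 8| ≤ 1 / 8 := by rw [abs_of_pos (by positivity)]; linarith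
  have hl2 : |-(ε / 8)| ≤ 1 / 8 := by rwa [abs_neg]
  have hup : μ.real {ω | N * (48 * ε) ≤ (∑ i, V i) ω} ≤ Real.exp (-((N : ℝ) * ε ^ 2)) := by
    refine (measure_ge_le_exp_mul_mgf _ (by positivity) (hsumint hl1)).trans ?_
    refine (mul_le_mul_of_nonneg_left (hsum hl1) (Real.exp_pos _).le).trans (le_of_eq ?_)
    rw [← Real.exp_add]
    congr 1
    ring
  have hlow : μ.real {ω | (∑ i, V i) ω ≤ -(N * (48 * ε))} ≤ Real.exp (-((N : ℝ) * ε ^ 2)) := by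
    refine (measure_le_le_exp_mul_mgf _ (by linarith) (hsumint hl2)).trans ?_
    refine (mul_le_mul_of_nonneg_left (hsum hl2) (Real.exp_pos _).le).trans (le_of_eq ?_)
    rw [← Real.exp_add]
    congr 1
    ring
  have hsub : {ω | 48 * ε < |1 / (N : ℝ) * ∑ i, φ (x i ω) - m|} ⊆
      {ω | N * (48 * ε) ≤ (∑ i, V i) ω} ∪ {ω | (∑ i, V i) ω ≤ -(N * (48 * ε))} := by
    intro ω hω
    have e : (∑ i, V i) ω = N * (1 / (N : ℝ) * ∑ i, φ (x i ω) - m) := by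
      rw [Finset.sum_apply]
      simp only [hV, hψ, Function.comp_apply, Finset.sum_sub_distrib, Finset.sum_const,
        Finset.card_univ, Fintype.card_fin, nsmul_eq_mul]
      field_simp
    rw [Set.mem_ofPred_eq] at hω
    simp only [Set.mem_union, Set.mem_ofPred_eq, e]
    rcases lt_abs.1 hω with h | h
    · exact Or.inl (mul_le_mul_of_nonneg_left h.le hN'.le)
    · right
      have := mul_le_mul_of_nonneg_left h.le hN'.le
      linarith
  calc _ ≤ _ := measureReal_mono hsub
    _ ≤ _ := measureReal_union_le _ _
    _ ≤ _ := by linarith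

/-! ### Concentration of the one-step gradient -/

section Gaussian
variable {E : Type*} [NormedAddCommGroup E] [InnerProductSpace ℝ E] [FiniteDimensional ℝ E]
  [MeasurableSpace E] [BorelSpace E]

/-- The AM–GM inequality, once in the exponent and once for the exponentials, reduces the product to
the two squares, each with exponential moment `√2 ≤ 3 / 2`. -/
theorem integrable_exp_abs_le_of_abs_le {v u : E} (hv : ‖v‖ = 1) (hu : ‖u‖ = 1) {φ : E → ℝ}
    (hφ : Measurable φ) (h : ∀ x, |φ x| ≤ |inner ℝ v x| * |inner ℝ u x|) :
    Integrable (fun x => Real.exp (|φ x| / 4)) (stdGaussian E) ∧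
      ∫ x, Real.exp (|φ x| / 4) ∂(stdGaussian E) ≤ 3 / 2 := by
  have hpt : ∀ x, Real.exp (|φ x| / 4) ≤ (1 / 2 : ℝ) *
      (Real.exp ((inner ℝ v x) ^ 2 / 4) + Real.exp ((inner ℝ u x) ^ 2 / 4)) := by
    intro x
    have h1 : |φ x| / 4 ≤ (inner ℝ v x) ^ 2 / 4 / 2 + (inner ℝ u x) ^ 2 / 4 / 2 := by
      have := sq_nonneg (|inner ℝ v x| - |inner ℝ u x|)
      have h2 := sq_abs (inner ℝ v x)
      have h3 := sq_abs (inner ℝ u x)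
      nlinarith [h x]
    refine (Real.exp_le_exp.2 h1).trans ?_
    rw [Real.exp_add, Real.exp_half, Real.exp_half]
    set p := Real.exp ((inner ℝ v x) ^ 2 / 4)
    set q := Real.exp ((inner ℝ u x) ^ 2 / 4)
    have hp : 0 ≤ p := (Real.exp_pos _).le
    have hq : 0 ≤ q := (Real.exp_pos _).le
    nlinarith [sq_nonneg (Real.sqrt p - Real.sqrt q), Real.sq_sqrt hp, Real.sq_sqrt hq]
  have hi := ((integrable_exp_inner_sq hv).add (integrable_exp_inner_sq hu)).const_mul (1 / 2)
  have hint : Integrable (fun x => Real.exp (|φ x| / 4)) (stdGaussian E) := by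
    refine hi.mono' (by fun_prop) (Filter.Eventually.of_forall fun x => ?_)
    rw [Real.norm_eq_abs, Real.abs_exp]
    exact hpt x
  refine ⟨hint, (integral_mono hint hi hpt).trans ?_⟩
  simp only [Pi.add_apply]
  rw [integral_const_mul, integral_add (integrable_exp_inner_sq hv) (integrable_exp_inner_sq hu),
    integral_exp_inner_sq hv, integral_exp_inner_sq hu]
  linarith [sqrt_two_le]

/-- Dividing by `‖b‖` makes the summand scale-free, so the deviation is proportional to the shift
and not to the size of the weights. -/
theorem measureReal_average_gatedShift_gt_le {Ω : Type*} [MeasurableSpace Ω] {μ : Measure Ω}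
    [IsProbabilityMeasure μ] {N : ℕ} (hN : 0 < N) {x : Fin N → Ω → E}
    (hlaw : ∀ i, HasLaw (x i) (stdGaussian E) μ) (hind : iIndepFun x μ) {v : E} (hv : ‖v‖ = 1)
    (a b : E) {ε : ℝ} (hε0 : 0 < ε) (hε1 : ε < 1) :
    μ.real {ω | 48 * ε * ‖b‖ < |1 / (N : ℝ) * ∑ i, inner ℝ v (x i ω) * gatedShift a b (x i ω) -
      ∫ y, inner ℝ v y * gatedShift a b y ∂(stdGaussian E)|} ≤
      2 * Real.exp (-((N : ℝ) * ε ^ 2)) := by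
  rcases eq_or_ne b 0 with rfl | hb
  · have : ∀ y : E, gatedShift a 0 y = 0 := fun y => by simp [gatedShift]
    simp [this, Real.exp_nonneg]
  have hb' : 0 < ‖b‖ := norm_pos_iff.2 hb
  set φ : E → ℝ := fun y => ‖b‖⁻¹ * (inner ℝ v y * gatedShift a b y) with hφ
  have hφm : Measurable φ :=
    ((by fun_prop : Measurable fun y : E => (inner ℝ v y : ℝ)).mul
      (measurable_gatedShift a b)).const_mul _
  have hφle : ∀ y, |φ y| ≤ |inner ℝ v y| * |inner ℝ ((‖b‖⁻¹ : ℝ) • b) y| := by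
    intro y
    rw [hφ, real_inner_smul_left, abs_mul, abs_mul, abs_mul, abs_of_pos (inv_pos.2 hb'),
      mul_left_comm]
    have := abs_gatedShift_le a b y
    gcongr
  obtain ⟨hi, hle⟩ := integrable_exp_abs_le_of_abs_le hv (norm_smul_inv_norm hb) hφm hφle
  refine le_trans (measureReal_mono fun ω hω => ?_)
    (measureReal_abs_average_sub_gt_le hN hlaw hind hφm hi hle hε0 hε1)
  rw [Set.mem_ofPred_eq] at hω ⊢
  simp only [hφ]
  rw [integral_const_mul, ← Finset.mul_sum, mul_left_comm, ← mul_sub, abs_mul,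
    abs_of_pos (inv_pos.2 hb'), ← div_eq_inv_mul, lt_div_iff₀ hb']
  exact hω

end Gaussian

/-- The `m`-th column as a Euclidean vector. -/
def colVec {d k : ℕ} (M : Matrix (Fin d) (Fin k) ℝ) (m : Fin k) : EuclideanSpace ℝ (Fin d) :=
  WithLp.toLp 2 fun i => M i m

theorem norm_colVec {d k : ℕ} (M : Matrix (Fin d) (Fin k) ℝ) (m : Fin k) :
    ‖colVec M m‖ = colNorm M m := by
  rw [EuclideanSpace.norm_eq, colNorm]
  simp [colVec]

theorem colNorm_nonneg {d k : ℕ} (M : Matrix (Fin d) (Fin k) ℝ) (m : Fin k) : 0 ≤ colNorm M m :=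
  Real.sqrt_nonneg _

theorem colVec_add {d k : ℕ} (M M' : Matrix (Fin d) (Fin k) ℝ) (m : Fin k) :
    colVec (M + M') m = colVec M m + colVec M' m := rfl

theorem dataMatrix_mul_apply {Ω : Type*} {N d k : ℕ} (x : Fin N → Ω → EuclideanSpace ℝ (Fin d))
    (ω : Ω) (M : Matrix (Fin d) (Fin k) ℝ) (i : Fin N) (m : Fin k) :
    (dataMatrix x ω * M) i m = inner ℝ (colVec M m) (x i ω) := by
  simp [Matrix.mul_apply, dataMatrix, colVec, PiLp.inner_apply]

theorem negGrad_dataMatrix_apply {Ω : Type*} {N d k : ℕ}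
    (x : Fin N → Ω → EuclideanSpace ℝ (Fin d)) (ω : Ω) (W Δ : Matrix (Fin d) (Fin k) ℝ)
    (j : Fin d) (m : Fin k) :
    negGrad (dataMatrix x ω) (W + Δ) W j m = 1 / (N : ℝ) * ∑ i,
      inner ℝ (EuclideanSpace.single j (1 : ℝ)) (x i ω) *
        gatedShift (colVec W m) (colVec Δ m) (x i ω) := by
  rw [negGrad, Matrix.smul_apply, Matrix.mul_apply, smul_eq_mul]
  congr 1
  refine Finset.sum_congr rfl fun i _ => ?_
  rw [Matrix.hadamard_apply, Matrix.sub_apply, Matrix.map_apply, Matrix.map_apply,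
    Matrix.map_apply, dataMatrix_mul_apply, dataMatrix_mul_apply, colVec_add, gatedShift,
    EuclideanSpace.inner_single_left]
  simp [dataMatrix]

/-- The expectation of the one-step gradient under standard Gaussian data. -/
def meanGrad {d k : ℕ} (W Δ : Matrix (Fin d) (Fin k) ℝ) : Matrix (Fin d) (Fin k) ℝ :=
  Matrix.of fun j m => ∫ y, inner ℝ (EuclideanSpace.single j (1 : ℝ)) y *
    gatedShift (colVec W m) (colVec Δ m) y ∂(stdGaussian (EuclideanSpace ℝ (Fin d)))

/-- Testing the bias against its own column `v` gives `‖v‖² ≤ 102 ‖v‖ ‖Δ_m‖² / ‖w̃_m‖`. Cancelling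
`‖v‖` yields a bound with no factor of the dimension. -/
theorem colNorm_meanGrad_sub_le {d k : ℕ} (W Δ : Matrix (Fin d) (Fin k) ℝ) (m : Fin k)
    (hm : 0 < colNorm (W + Δ) m) :
    colNorm (meanGrad W Δ - (1 / 2 : ℝ) • Δ) m ≤
      102 * (colNorm Δ m ^ 2 / colNorm (W + Δ) m) := by
  set v := colVec (meanGrad W Δ - (1 / 2 : ℝ) • Δ) m with hv
  have hne : colVec W m + colVec Δ m ≠ 0 := by
    rw [← colVec_add, ← norm_pos_iff, norm_colVec]; exact hm
  have h := abs_integral_inner_mul_gatedShift_sub_le v (colVec W m) hne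
  rw [← colVec_add, norm_colVec Δ, norm_colVec (W + Δ)] at h
  have hint : ∫ y, inner ℝ v y * gatedShift (colVec W m) (colVec Δ m) y
      ∂(stdGaussian (EuclideanSpace ℝ (Fin d))) = ∑ j, v j * meanGrad W Δ j m := by
    have hexp : ∀ y : EuclideanSpace ℝ (Fin d),
        inner ℝ v y * gatedShift (colVec W m) (colVec Δ m) y =
        ∑ j, v j * (inner ℝ (EuclideanSpace.single j (1 : ℝ)) y *
          gatedShift (colVec W m) (colVec Δ m) y) := by
      intro y
      simp only [← mul_assoc]
      rw [← Finset.sum_mul]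
      congr 1
      simp [PiLp.inner_apply, mul_comm]
    simp only [hexp]
    rw [integral_finsetSum _ fun j _ => (integrable_inner_mul_gatedShift _ _ _).const_mul _]
    simp only [integral_const_mul]
    rfl
  have hinner : inner ℝ v (colVec Δ m) / 2 = ∑ j, v j * (Δ j m / 2) := by
    simp only [PiLp.inner_apply, colVec, Finset.sum_div, RCLike.inner_apply, conj_trivial]
    exact Finset.sum_congr rfl fun j _ => by ring
  have hself : ∑ j, v j * meanGrad W Δ j m - ∑ j, v j * (Δ j m / 2) = ‖v‖ ^ 2 := by
    rw [EuclideanSpace.norm_sq_eq, ← Finset.sum_sub_distrib]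
    refine Finset.sum_congr rfl fun j _ => ?_
    have : v j = meanGrad W Δ j m - 1 / 2 * Δ j m := rfl
    rw [Real.norm_eq_abs, sq_abs, this]
    ring
  rw [hint, hinner, hself, abs_of_nonneg (sq_nonneg _)] at h
  rw [← norm_colVec, ← hv]
  rcases eq_or_lt_of_le (norm_nonneg v) with h0 | h0
  · rw [← h0]; positivity
  · refine le_of_mul_le_mul_left ?_ h0
    calc ‖v‖ * ‖v‖ = ‖v‖ ^ 2 := (sq _).symm
      _ ≤ _ := h
      _ = _ := by ring

theorem colNorm_le_of_abs_le {d k : ℕ} (M : Matrix (Fin d) (Fin k) ℝ) (m : Fin k) {c : ℝ}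
    (hc : 0 ≤ c) (h : ∀ j, |M j m| ≤ c) : colNorm M m ≤ Real.sqrt d * c := by
  rw [colNorm, Real.sqrt_le_left (by positivity), mul_pow, Real.sq_sqrt (Nat.cast_nonneg _)]
  calc ∑ j, M j m ^ 2 ≤ ∑ _j : Fin d, c ^ 2 :=
        Finset.sum_le_sum fun j _ => sq_le_sq' (abs_le.1 (h j)).1 (abs_le.1 (h j)).2
    _ = d * c ^ 2 := by simp

/-- The one-step gradient is entrywise close to its expectation with high probability. -/
theorem exists_measurableSet_abs_negGrad_sub_le {Ω : Type*} [MeasurableSpace Ω] {μ : Measure Ω}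
    [IsProbabilityMeasure μ] {N d k : ℕ} (hN : 0 < N) {x : Fin N → Ω → EuclideanSpace ℝ (Fin d)}
    (hx : IsGaussianSample μ x) (W Δ : Matrix (Fin d) (Fin k) ℝ) {ε : ℝ} (hε0 : 0 < ε)
    (hε1 : ε < 1) :
    ∃ S : Set Ω, MeasurableSet S ∧
      1 - 2 * (d : ℝ) * (k : ℝ) * Real.exp (-((N : ℝ) * ε ^ 2)) ≤ μ.real S ∧
      ∀ ω ∈ S, ∀ j m, |(negGrad (dataMatrix x ω) (W + Δ) W - meanGrad W Δ) j m| ≤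
        48 * ε * colNorm Δ m := by
  set bad : Fin d × Fin k → Set Ω := fun p =>
    {ω | 48 * ε * colNorm Δ p.2 <
      |(negGrad (dataMatrix x ω) (W + Δ) W - meanGrad W Δ) p.1 p.2|} with hbad
  have hle : ∀ p, μ.real (bad p) ≤ 2 * Real.exp (-((N : ℝ) * ε ^ 2)) := by
    intro p
    have h := measureReal_average_gatedShift_gt_le hN hx.law hx.indep
      (v := EuclideanSpace.single p.1 (1 : ℝ)) (by simp) (colVec W p.2) (colVec Δ p.2) hε0 hε1
    simp only [norm_colVec, ← negGrad_dataMatrix_apply] at h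
    exact h
  have hunion : μ.real (⋃ p, bad p) ≤ 2 * (d : ℝ) * (k : ℝ) * Real.exp (-((N : ℝ) * ε ^ 2)) := by
    calc μ.real (⋃ p, bad p) ≤ ∑ p, μ.real (bad p) := measureReal_iUnion_fintype_le _
      _ ≤ ∑ _p : Fin d × Fin k, 2 * Real.exp (-((N : ℝ) * ε ^ 2)) :=
          Finset.sum_le_sum fun p _ => hle p
      _ = _ := by
          rw [Finset.sum_const, Finset.card_univ, Fintype.card_prod, Fintype.card_fin,
            Fintype.card_fin, nsmul_eq_mul, Nat.cast_mul]
          ring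
  -- The sample is only almost everywhere measurable, so the bad event is replaced by a measurable
  -- hull of the same measure.
  refine ⟨(toMeasurable μ (⋃ p, bad p))ᶜ, (measurableSet_toMeasurable _ _).compl, ?_, ?_⟩
  · rw [probReal_compl_eq_one_sub (measurableSet_toMeasurable _ _), Measure.real,
      measure_toMeasurable]
    exact sub_le_sub_left hunion 1
  · intro ω hω j m
    by_contra hcon
    exact hω (subset_toMeasurable _ _ (Set.mem_iUnion.2 ⟨(j, m), not_le.1 hcon⟩))

theorem frobNorm_le_condNumber_mul {d k : ℕ} {Δ : Matrix (Fin d) (Fin k) ℝ} (h : 1 ≤ Δ.rank) :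
    frobNorm Δ ≤ Real.sqrt Δ.rank * (condNumber Δ * singularValue Δ Δ.rank) := by
  rw [condNumber, div_mul_cancel₀ _ (singularValue_rank_pos h).ne']
  exact frobNorm_le_sqrt_rank_mul Δ

end LoRA

end

/-! ### Assembly of the error budget. -/

theorem mainTheorem7 :
    ∃ C > (0 : ℝ), ∃ Cstar > (0 : ℝ), ∀ c₁ > (0 : ℝ), ∃ c₀ > (0 : ℝ),
      ∀ (ρ c₂ : ℝ), 0 < ρ → 0 < c₂ → c₂ ≤ c₀ * ρ →
      ∀ (d k N r : ℕ) (hr0 : 1 ≤ r) (hr : r < min d k) (_hdN : d < N)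
        (W Δ : Matrix (Fin d) (Fin k) ℝ) (_hrank : Δ.rank = r)
        (_hshift : LoRA.ShiftAssumption c₁ c₂ r (W + Δ) Δ)
        (Ω : Type*) [MeasurableSpace Ω] (μ : Measure Ω) [IsProbabilityMeasure μ]
        (x : Fin N → Ω → EuclideanSpace ℝ (Fin d)) (_hx : LoRA.IsGaussianSample μ x)
        (ε : ℝ), 0 < ε → ε < 1 →
        ε ≤ ρ / (3 * Cstar * Real.sqrt (8 / 3) ^ 2 * 2 * Real.sqrt (2 * (d : ℝ)) * (r : ℝ) *
          LoRA.condNumber Δ) →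
        ∃ E : Set Ω, MeasurableSet E ∧
          1 - 2 * C * (d : ℝ) * (k : ℝ) * Real.exp (-((N : ℝ) * ε ^ 2)) ≤ μ.real E ∧
          ∀ ω ∈ E, ∀ (A₀ : Matrix (Fin d) (Fin r) ℝ) (B₀ : Matrix (Fin r) (Fin k) ℝ),
            LoRA.IsSpectralInit 2 hr.le
              (LoRA.negGrad (LoRA.dataMatrix x ω) (W + Δ) W) A₀ B₀ →
            LoRA.frobNorm (A₀ * B₀ - Δ) ≤ ρ * LoRA.singularValue Δ r := by
  open LoRA in
  -- The deviation and the bias may each use `ρ λ_r / 8`, since recovery multiplies their sum by 4.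
  -- This requires `3 * 24 * (8 / 3) * 2 = 8 * 48` and `816 = 8 * 102`.
  refine ⟨1, one_pos, 24, by norm_num, fun c₁ _ => ⟨1 / 816, by norm_num, ?_⟩⟩
  intro ρ c₂ hρ hc₂ hc d k N r hr0 hr hdN W Δ hrank hshift Ω _ μ _ x hx ε hε0 hε1 hε
  obtain ⟨S, hS, hSμ, hSle⟩ := exists_measurableSet_abs_negGrad_sub_le (Nat.zero_lt_of_lt hdN) hx
    W Δ hε0 hε1
  refine ⟨S, hS, by simpa only [mul_one] using hSμ, fun ω hω A₀ B₀ hAB => ?_⟩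
  have hrank1 : 1 ≤ Δ.rank := hrank ▸ hr0
  have hκ : 1 ≤ condNumber Δ := one_le_condNumber hrank1
  have hσ : 0 < singularValue Δ r := hrank ▸ singularValue_rank_pos hrank1
  have hfrob := frobNorm_le_condNumber_mul hrank1
  rw [hrank] at hfrob
  set κ := condNumber Δ
  set σ := singularValue Δ r
  set G := negGrad (dataMatrix x ω) (W + Δ) W with hG
  have hd : (0 : ℝ) < d := by
    have : 0 < d := by omega
    exact_mod_cast this
  have hr1 : (1 : ℝ) ≤ r := by exact_mod_cast hr0
  have hκr : 0 < κ * r := by positivity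
  -- The factor `√d` enters here, in passing from entries to columns.
  have h1 : frobNorm (G - meanGrad W Δ) ≤ 48 * ε * Real.sqrt d * frobNorm Δ := by
    refine frobNorm_le_of_colNorm_le (by positivity) fun m => ?_
    refine (colNorm_le_of_abs_le _ m (c := 48 * ε * colNorm Δ m) ?_
      fun j => hSle ω hω j m).trans (le_of_eq (by ring))
    exact mul_nonneg (by positivity) (colNorm_nonneg Δ m)
  have h2 : frobNorm (meanGrad W Δ - (1 / 2 : ℝ) • Δ) ≤ 102 * (c₂ / (κ * r)) * frobNorm Δ := by
    refine frobNorm_le_of_colNorm_le (by positivity) fun m => ?_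
    have hm := hshift.col_pos m
    have h3 : colNorm Δ m / colNorm (W + Δ) m ≤ c₂ / (κ * r) :=
      (div_le_div_of_nonneg_right (le_max_right _ _) hm.le).trans (hshift.shift m)
    have h4 := mul_le_mul_of_nonneg_right h3 (colNorm_nonneg Δ m)
    have h5 : colNorm Δ m ^ 2 / colNorm (W + Δ) m =
        colNorm Δ m / colNorm (W + Δ) m * colNorm Δ m := by ring
    have h6 := colNorm_meanGrad_sub_le W Δ m hm
    rw [h5] at h6
    linarith
  have h3 : frobNorm (G - (1 / 2 : ℝ) • Δ) ≤
      (48 * ε * Real.sqrt d + 102 * (c₂ / (κ * r))) * (Real.sqrt r * (κ * σ)) := by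
    have h4 := frobNorm_add_le (G - meanGrad W Δ) (meanGrad W Δ - (1 / 2 : ℝ) • Δ)
    rw [sub_add_sub_cancel] at h4
    calc _ ≤ (48 * ε * Real.sqrt d + 102 * (c₂ / (κ * r))) * frobNorm Δ := by linarith
      _ ≤ _ := mul_le_mul_of_nonneg_left hfrob (by positivity)
  have hsr : Real.sqrt r ≤ r := by
    rw [Real.sqrt_le_left (by positivity)]; nlinarith
  have hsd : Real.sqrt d ≤ Real.sqrt (2 * d) := Real.sqrt_le_sqrt (by linarith)
  have hκ0 : 0 < κ := by linarith
  have hs2d : 0 < Real.sqrt (2 * d) := Real.sqrt_pos.2 (by positivity)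
  have h4 : 48 * ε * Real.sqrt d * (Real.sqrt r * (κ * σ)) ≤ ρ * σ / 8 := by
    rw [Real.sq_sqrt (by norm_num), le_div_iff₀ (by positivity)] at hε
    calc 48 * ε * Real.sqrt d * (Real.sqrt r * (κ * σ))
        ≤ 48 * ε * Real.sqrt (2 * d) * (r * (κ * σ)) := by gcongr
      _ = (ε * (3 * 24 * (8 / 3) * 2 * Real.sqrt (2 * d) * r * κ)) * σ / 8 := by ring
      _ ≤ ρ * σ / 8 := by gcongr
  have h5 : 102 * (c₂ / (κ * r)) * (Real.sqrt r * (κ * σ)) ≤ ρ * σ / 8 := by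
    calc 102 * (c₂ / (κ * r)) * (Real.sqrt r * (κ * σ))
        ≤ 102 * (c₂ / (κ * r)) * (r * (κ * σ)) := by gcongr
      _ = 102 * c₂ * σ := by field_simp
      _ ≤ 102 * (1 / 816 * ρ) * σ := by gcongr
      _ = ρ * σ / 8 := by ring
  have h6 := hAB.frobNorm_mul_sub_le hr hrank.le
  linarith
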